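/- **Setting.** Let $\Sigma_n=\{-1,1\}^n$, let $d_H$ be the Hamming distance and $\|\cdot\|_F$ the Frobenius norm. A *randomized algorithm* is a (jointly measurable) map $\mathcal A:\mathbb R^{M\times n}\times\Omega\to\Sigma_n$, where $(\Omega,\mathbb P_\omega)$ is a probability space. It is $(K,\rho,p_f,p_{\rm st},f,L)$-*stable* (in dimensions $M\times n$) if * (Success) for $\mathcal M\in\mathbb R^{M\times n}$ with i.i.d. $\mathcal N(0,1)$ entries, independent of $\omega\sim\mathbb P_\omega$, $\ \mathbb P_{(\mathcal M,\omega)}\bigl[\|\mathcal M\mathcal A(\mathcal M,\omega)\|_\infty\le K\bigr]\ge 1-p_f$; * (Stability) for $\mathcal M,\overline{\mathcal M}\in\mathbb R^{M\times n}$, independent of $\omega$, such that the pairs $(\mathcal M_{ij},\overline{\mathcal M}_{ij})$ are i.i.d. bivariate normal with standard normal marginals and correlation $\rho$, $\ \mathbb P_{(\mathcal M,\overline{\mathcal M},\omega)}\bigl[d_H(\mathcal A(\mathcal M,\omega),\mathcal A(\overline{\mathcal M},\omega))\le f+L\|\mathcal M-\overline{\mathcal M}\|_F\bigr]\ge 1-p_{\rm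 st}$. **m-OGP parameters.** Fix $K>0$ and $C_1>c_2>0$, and consider pairs $(M,n)$ of natural numbers with $$C_1M\log_2M\ \ge\ n\ \ge\ c_2M\log_2M.\tag{1}$$ Let $h_b(p)=-p\log_2p-(1-p)\log_2(1-p)$ and let $$m=\max\{2,\lceil16C_1\rceil\},\qquad \beta\in(\tfrac12,1)\ \text{ with }\ h_b(1-\beta)=\min\Bigl\{\frac1{4C_1},\frac12\Bigr\},\qquad \eta=\frac{1-\beta}{2m}.$$ **Theorem.** We have $0<\eta<\beta<1$, and the following hold. 1. (The parameters $m,\beta,\eta$ are $m$-OGP parameters.) There are $c>0$, $\delta>0$ and $n_0\in\mathbb N$ such that for every $(M,n)$ satisfying (1) with $n\ge n_0$ and every $\mathcal I\subset[0,\pi/2]$ with $|\mathcal I|\le2^{cn}$: if $\mathcal M_0,\dots,\mathcal M_m\in\mathbb R^{M\times n}$ are independent with i.i.d. $\mathcal N(0,1)$ entries, then with probability at least $1-2^{-\delta n}$ there are no $\boldsymbol\sigma_1,\dots,\boldsymbol\sigma_m\in\Sigma_n$ and $\tau_1,\dots,\tau_m\in\mathcal I$ with $\beta-\eta\le n^{-1}\langle\boldsymbol\sigma_i,\boldsymbol\sigma_j\rangle\le\beta$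 for all $1\le i<j\le m$ and $\max_{1\le i\le m}\|(\cos(\tau_i)\mathcal M_0+\sin(\tau_i)\mathcal M_i)\boldsymbol\sigma_i\|_\infty\le K$. 2. (Failure of stable algorithms.) For every $\mathcal L>0$, set $$C=\frac{\eta^2}{1600},\qquad Q=\Bigl\lceil\frac{4800\,\mathcal L\,\pi}{\eta^2}\Bigr\rceil,\qquad T=2^{\,2^{\,4mQ\log_2Q}}.$$ Then there is an $n_0\in\mathbb N$ such that for every $(M,n)$ satisfying (1) with $n\ge n_0$ there is no randomized algorithm $\mathcal A:\mathbb R^{M\times n}\times\Omega\to\Sigma_n$ which is $$\Bigl(K,\ \cos\bigl(\tfrac{\pi}{2Q}\bigr),\ \tfrac1{9(Q+1)T},\ \tfrac1{9Q(T+1)},\ Cn,\ \mathcal L\sqrt{n/M}\Bigr)\text{-stable}.$$ -/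

import Mathlib

open MeasureTheory ProbabilityTheory

noncomputable section

namespace StableDisc

/-- Matrices carry the product (Borel) σ-algebra of `ℝ^(M × n)`. -/
instance instMeasurableSpaceMatrix (M n : ℕ) : MeasurableSpace (Matrix (Fin M) (Fin n) ℝ) :=
  inferInstanceAs (MeasurableSpace (Fin M → Fin n → ℝ))

/-- The cube `{-1, 1}ⁿ`: the units of `ℤ` are exactly `1` and `-1`. -/
abbrev Cube (n : ℕ) : Type := Fin n → ℤˣ

/-- A point of the cube as a real vector. -/
def toVec {n : ℕ} (σ : Cube n) : Fin n → ℝ := fun j => ((σ j : ℤ) : ℝ)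

/-- The normalized overlap `n⁻¹ ⟨σ, σ'⟩`. -/
def overlap {n : ℕ} (σ σ' : Cube n) : ℝ := (n : ℝ)⁻¹ * (toVec σ ⬝ᵥ toVec σ')

/-- `‖X σ‖_∞`; the norm of `Fin M → ℝ` is the sup norm. -/
def disc {M n : ℕ} (X : Matrix (Fin M) (Fin n) ℝ) (σ : Cube n) : ℝ :=
  ‖Matrix.mulVec X (toVec σ)‖

/-- The Frobenius norm of a matrix. -/
def frobNorm {M n : ℕ} (X : Matrix (Fin M) (Fin n) ℝ) : ℝ :=
  Real.sqrt (∑ i, ∑ j, X i j ^ 2)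

/-- The law of an `M × n` matrix with i.i.d. standard normal entries. -/
def gaussianMatrix (M n : ℕ) : Measure (Matrix (Fin M) (Fin n) ℝ) :=
  Measure.pi fun _ : Fin M => Measure.pi fun _ : Fin n => gaussianReal 0 1

/-- The law of a pair `(X, Y)` of `M × n` standard normal matrices such that the pairs
`(X i j, Y i j)` are i.i.d. bivariate normal with correlation `ρ`, for `-1 ≤ ρ ≤ 1`. -/
def correlatedPair (M n : ℕ) (ρ : ℝ) :
    Measure (Matrix (Fin M) (Fin n) ℝ × Matrix (Fin M) (Fin n) ℝ) :=
  ((gaussianMatrix M n).prod (gaussianMatrix M n)).map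
    fun p => (p.1, ρ • p.1 + Real.sqrt (1 - ρ ^ 2) • p.2)

/-- Binary entropy, with logarithms in base 2. -/
def entropy2 (p : ℝ) : ℝ := -p * Real.logb 2 p - (1 - p) * Real.logb 2 (1 - p)

/-- The interpolated matrix `cos τ • G 0 + sin τ • G i`, for `i = 1, …, m`. -/
def interp {M n m : ℕ} (G : Fin (m + 1) → Matrix (Fin M) (Fin n) ℝ) (i : Fin m) (τ : ℝ) :
    Matrix (Fin M) (Fin n) ℝ :=
  Real.cos τ • G 0 + Real.sin τ • G i.succ

/-- The set of `m`-tuples with all pairwise overlaps in `[β - η, β]` whose `i`-th member has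
discrepancy at most `K` for some interpolated matrix with angle in `I`. -/
def ogpSet {M n m : ℕ} (K β η : ℝ) (I : Finset ℝ)
    (G : Fin (m + 1) → Matrix (Fin M) (Fin n) ℝ) : Set (Fin m → Cube n) :=
  {σ | (∀ i j : Fin m, i < j → β - η ≤ overlap (σ i) (σ j) ∧ overlap (σ i) (σ j) ≤ β) ∧
    ∃ τ : Fin m → ℝ, ∀ i, τ i ∈ I ∧ disc (interp G i (τ i)) (σ i) ≤ K}

/-- The scaling `C₁ M log₂ M ≥ n ≥ c₂ M log₂ M`. -/
def Regime (C₁ c₂ : ℝ) (M n : ℕ) : Prop :=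
  (n : ℝ) ≤ C₁ * M * Real.logb 2 M ∧ c₂ * M * Real.logb 2 M ≤ n

/-- The ensemble `m`-OGP with parameters `m, β, η` throughout the regime: for some `c > 0`, the
probability that `ogpSet` is nonempty is exponentially small in `n`, at a rate that is uniform
over `M` and over all sets of at most `2 ^ (c n)` angles in `[0, π / 2]`. -/
def EnsembleOGP (K C₁ c₂ : ℝ) (m : ℕ) (β η : ℝ) : Prop :=
  ∃ c : ℝ, 0 < c ∧ ∃ δ : ℝ, 0 < δ ∧ ∃ n₀ : ℕ, ∀ n : ℕ, n₀ ≤ n → ∀ M : ℕ, Regime C₁ c₂ M n →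
    ∀ I : Finset ℝ, (∀ τ ∈ I, 0 ≤ τ ∧ τ ≤ Real.pi / 2) →
      (I.card : ℝ) ≤ (2 : ℝ) ^ (c * (n : ℝ)) →
      (Measure.pi fun _ : Fin (m + 1) => gaussianMatrix M n).real
        {G | (ogpSet K β η I G).Nonempty} ≤ (2 : ℝ) ^ (-(δ * (n : ℝ)))

/-- The randomized algorithm `A`, with internal randomness `ω` of law `P`, is
`(K, ρ, p_f, p_st, f, L)`-stable in dimensions `M × n`. The two runs in the stability condition
share the same `ω`. -/
def IsStable {M n : ℕ} {Ω : Type*} [MeasurableSpace Ω] (P : Measure Ω)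
    (A : Matrix (Fin M) (Fin n) ℝ → Ω → Cube n) (K ρ p_f p_st f L : ℝ) : Prop :=
  1 - p_f ≤ ((gaussianMatrix M n).prod P).real {q | disc q.1 (A q.1 q.2) ≤ K} ∧
  1 - p_st ≤ ((correlatedPair M n ρ).prod P).real
    {q | (hammingDist (A q.1.1 q.2) (A q.1.2 q.2) : ℝ) ≤ f + L * frobNorm (q.1.1 - q.1.2)}

/-- The tuple size `m = max {2, ⌈16 C₁⌉}`. -/
def ogpSize (C₁ : ℝ) : ℕ := max 2 ⌈16 * C₁⌉₊

/-- The overlap width `η = (1 - β) / (2 m)`. -/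
def ogpWidth (m : ℕ) (β : ℝ) : ℝ := (1 - β) / (2 * (m : ℝ))

/-- `C = η² / 1600`. -/
def constC (η : ℝ) : ℝ := η ^ 2 / 1600

/-- The number of interpolation steps `Q = ⌈4800 L π / η²⌉`. -/
def constQ (L η : ℝ) : ℕ := ⌈4800 * L * Real.pi / η ^ 2⌉₊

/-- `T = 2 ^ (2 ^ (4 m Q log₂ Q))`. -/
def constT (m Q : ℕ) : ℝ :=
  (2 : ℝ) ^ ((2 : ℝ) ^ (4 * (m : ℝ) * (Q : ℝ) * Real.logb 2 (Q : ℝ)))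

end StableDisc

end

noncomputable section

namespace StableDisc

/-! Part 1 is a first moment argument. All members of an admissible tuple lie in the Hamming ball of
radius `(1 - β) n` about the first one, so there are at most `2 ^ (n (1 + (m - 1) h_b(1 - β)))`
tuples. Their Gram matrix is close to `n (β J + (1 - β) I)`, with `J` the all-ones matrix; since `η
m = (1 - β) / 2`, it is at least `(1 - β) n / 2`. The small ball bound is therefore `O(n ^ (-1/2))`
per coordinate, hence at most `2 ^ (-m n / (2 C₁))` over the `m M` coordinates in the regime. The
parameters make the product at most `2 ^ (-3 n)`, which leaves room for a union bound over angles.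

For part 2, suppose that a stable algorithm exists. Run it, with one `ω`, along the `Q`-step
rotations from `M₀` to each of `R` independent matrices. For a single path, success, stability and
moderate norms hold together with probability at least `1/2`. By Jensen, conditionally on `(M₀, ω)`,
they hold for all `R` paths with probability at least `2 ^ (-R)`. All paths start at the same point
and each step changes overlaps by at most `η`, so an overlap cannot jump across `[β - η, β]`.

Colour a pair of paths by a time at which its overlap is in the window, or by `none` if there is no
such time. Ramsey's theorem gives `m` paths with a single colour (`exists_forbidden_tuple`). With a
time as colour they form a tuple forbidden by the first moment bound. With `none`, all final
overlaps exceed `β`; but the final angle is `π / 2`, where the matrices are independent and the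
small ball bound needs no upper bound on overlaps. `exists_forall_prob_exists_tuple_le` treats both
cases. As `R` depends only on `m` and `Q`, the constant `2 ^ (-R)` eventually exceeds the
exponentially small bound. -/

/-! ### Hamming geometry and counting in the cube -/

lemma toVec_sq {n : ℕ} (σ : Cube n) (j : Fin n) : toVec σ j ^ 2 = 1 := by
  rcases Int.units_eq_one_or (σ j) with h | h <;> simp [toVec, h]

lemma toVec_mul_toVec {n : ℕ} (σ σ' : Cube n) (j : Fin n) :
    toVec σ j * toVec σ' j = 1 - 2 * (if σ j ≠ σ' j then 1 else 0) := by
  rcases Int.units_eq_one_or (σ j) with h | h <;>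
    rcases Int.units_eq_one_or (σ' j) with h' | h' <;> norm_num [toVec, h, h']

lemma dotProduct_toVec {n : ℕ} (σ σ' : Cube n) :
    toVec σ ⬝ᵥ toVec σ' = n - 2 * hammingDist σ σ' := by
  simp only [dotProduct, toVec_mul_toVec, Finset.sum_sub_distrib, ← Finset.mul_sum, hammingDist,
    Finset.sum_boole]
  simp

lemma overlap_eq {n : ℕ} (hn : 0 < n) (σ σ' : Cube n) :
    overlap σ σ' = 1 - 2 * hammingDist σ σ' / n := by
  have : (n : ℝ) ≠ 0 := by positivity
  rw [overlap, dotProduct_toVec]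
  field_simp

lemma overlap_comm {n : ℕ} (σ σ' : Cube n) : overlap σ σ' = overlap σ' σ := by
  rw [overlap, overlap, dotProduct_comm]

lemma overlap_self {n : ℕ} (hn : 0 < n) (σ : Cube n) : overlap σ σ = 1 := by
  simp [overlap_eq hn]

/-- The volume of a Hamming ball of radius `p n` is at most `2 ^ (n h(p))`. -/
lemma card_hamming_ball_le {n : ℕ} (σ : Cube n) {p : ℝ} (hp : 0 < p) (hp2 : p ≤ 1 / 2) :
    ((Finset.univ.filter fun σ' : Cube n => (hammingDist σ σ' : ℝ) ≤ p * n).card : ℝ) ≤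
      (2 : ℝ) ^ (n * entropy2 p) := by
  have hq : 0 < 1 - p := by linarith
  set B := Finset.univ.filter fun σ' : Cube n => (hammingDist σ σ' : ℝ) ≤ p * n
  -- Flip each coordinate of `σ` independently with probability `p`. Total mass is one, and since `p
  -- ≤ 1 - p` each point of the ball has mass at least that on the sphere of radius `p n`, namely `2
  -- ^ (-n h(p))`.
  have htot : ∑ σ' : Cube n, ∏ j, (if σ j ≠ σ' j then p else 1 - p) = 1 := by
    rw [← Fintype.piFinset_univ, Finset.sum_prod_piFinset Finset.univ
      (fun j (u : ℤˣ) => if σ j ≠ u then p else 1 - p)]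
    refine Finset.prod_eq_one fun j _ => ?_
    rcases Int.units_eq_one_or (σ j) with h | h <;> simp [h]
  have hlog : (2 : ℝ) ^ (-(n * entropy2 p)) = p ^ (p * n) * (1 - p) ^ ((1 - p) * n) := by
    have e1 : p = (2 : ℝ) ^ Real.logb 2 p := (Real.rpow_logb (by norm_num) (by norm_num) hp).symm
    have e2 : 1 - p = (2 : ℝ) ^ Real.logb 2 (1 - p) :=
      (Real.rpow_logb (by norm_num) (by norm_num) hq).symm
    have e3 : p ^ (p * n) = (2 : ℝ) ^ (Real.logb 2 p * (p * n)) := by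
      rw [Real.rpow_mul zero_le_two, ← e1]
    have e4 : (1 - p) ^ ((1 - p) * n) = (2 : ℝ) ^ (Real.logb 2 (1 - p) * ((1 - p) * n)) := by
      rw [Real.rpow_mul zero_le_two, ← e2]
    rw [e3, e4, ← Real.rpow_add (by norm_num), entropy2]
    congr 1; ring
  have hterm : ∀ σ' ∈ B, (2 : ℝ) ^ (-(n * entropy2 p)) ≤
      ∏ j, (if σ j ≠ σ' j then p else 1 - p) := by
    intro σ' hσ'
    have hd : (hammingDist σ σ' : ℝ) ≤ p * n := (Finset.mem_filter.1 hσ').2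
    have hprod : ∏ j, (if σ j ≠ σ' j then p else 1 - p) =
        p ^ (hammingDist σ σ' : ℝ) * (1 - p) ^ (n - hammingDist σ σ' : ℝ) := by
      have hle : hammingDist σ σ' ≤ n := by simpa using hammingDist_le_card_fintype (x := σ) (y := σ')
      rw [Finset.prod_ite, Finset.prod_const, Finset.prod_const, ← Nat.cast_sub hle,
        Real.rpow_natCast, Real.rpow_natCast]
      congr 2
      have := Finset.card_filter_add_card_filter_not (s := (Finset.univ : Finset (Fin n)))
        (fun j => σ j ≠ σ' j)
      simp only [Finset.card_univ, Fintype.card_fin] at this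
      simp only [hammingDist]
      omega
    rw [hlog, hprod]
    have s1 : p ^ (p * n) = p ^ (hammingDist σ σ' : ℝ) * p ^ (p * n - hammingDist σ σ') := by
      rw [← Real.rpow_add hp]; congr 1; ring
    have s2 : (1 - p) ^ (n - hammingDist σ σ' : ℝ) =
        (1 - p) ^ (p * n - hammingDist σ σ' : ℝ) * (1 - p) ^ ((1 - p) * n) := by
      rw [← Real.rpow_add hq]; congr 1; ring
    rw [s1, s2, mul_assoc]
    gcongr
    linarith
  have h1 : (B.card : ℝ) * (2 : ℝ) ^ (-(n * entropy2 p)) ≤ 1 := by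
    rw [← nsmul_eq_mul, ← htot]
    refine (Finset.card_nsmul_le_sum B _ _ hterm).trans ?_
    refine Finset.sum_le_sum_of_subset_of_nonneg (Finset.filter_subset _ _) fun σ' _ _ => ?_
    exact Finset.prod_nonneg fun j _ => by split_ifs <;> linarith
  rw [Real.rpow_neg (by norm_num), ← div_eq_mul_inv, div_le_one (by positivity)] at h1
  exact h1

/-- The number of tuples all of whose members are close to the first one. -/
lemma card_tuples_le {n k : ℕ} {p : ℝ} (hp : 0 < p) (hp2 : p ≤ 1 / 2)
    (S : Finset (Fin (k + 1) → Cube n))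
    (hS : ∀ σ ∈ S, ∀ i : Fin k, (hammingDist (σ 0) (σ i.succ) : ℝ) ≤ p * n) :
    (S.card : ℝ) ≤ (2 : ℝ) ^ (n * (1 + k * entropy2 p)) := by
  classical
  let B : Cube n → Finset (Cube n) := fun s =>
    Finset.univ.filter fun σ' : Cube n => (hammingDist s σ' : ℝ) ≤ p * n
  let U : Finset (Σ _ : Cube n, Fin k → Cube n) :=
    (Finset.univ : Finset (Cube n)).sigma fun s => Fintype.piFinset fun _ : Fin k => B s
  have h1 : S.card ≤ U.card := by
    refine Finset.card_le_card_of_injOn (fun σ => ⟨σ 0, fun i => σ i.succ⟩) ?_ ?_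
    · intro σ hσ
      simp only [U, B, Finset.coe_sigma, Set.mem_sigma_iff, Finset.mem_coe, Finset.mem_univ,
        Fintype.mem_piFinset, Finset.mem_filter, true_and]
      exact hS σ hσ
    · intro σ _ σ' _ h
      simp only [Sigma.mk.injEq, heq_eq_eq] at h
      funext i
      refine Fin.cases h.1 (fun i => congrFun h.2 i) i
  have h2 : (U.card : ℝ) ≤ ∑ s : Cube n, ((2 : ℝ) ^ (n * entropy2 p)) ^ k := by
    simp only [U, Finset.card_sigma, Fintype.card_piFinset, Finset.prod_const, Finset.card_univ,
      Fintype.card_fin]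
    push_cast
    exact Finset.sum_le_sum fun s _ =>
      pow_le_pow_left₀ (by positivity) (card_hamming_ball_le s hp hp2) _
  refine (Nat.cast_le.2 h1).trans (h2.trans (le_of_eq ?_))
  rw [Finset.sum_const, Finset.card_univ, nsmul_eq_mul, Fintype.card_fun, Fintype.card_units_int,
    Fintype.card_fin, ← Real.rpow_natCast, ← Real.rpow_mul (by norm_num)]
  push_cast
  rw [← Real.rpow_natCast 2 n, ← Real.rpow_add (by norm_num)]
  congr 1; ring

/-! ### Nondegeneracy of the covariance forms -/

/-- Lower bound for the Gram form of vectors with pairwise overlaps in `[β - η, β]`. -/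
lemma gram_form_ge {n m : ℕ} (hn : 0 < n) {β η : ℝ} (hβ : 0 ≤ β) (hη : 0 ≤ η)
    (hw : η * m ≤ (1 - β) / 2) (σ : Fin m → Cube n)
    (hσ : ∀ i j : Fin m, i < j → β - η ≤ overlap (σ i) (σ j) ∧ overlap (σ i) (σ j) ≤ β)
    (x : Fin m → ℝ) :
    (1 - β) / 2 * n * ∑ i, x i ^ 2 ≤ ∑ j, (∑ i, x i * toVec (σ i) j) ^ 2 := by
  have hn' : (0 : ℝ) < n := by positivity
  have hne : ∀ i k : Fin m, i ≠ k → |overlap (σ i) (σ k) - β| ≤ η := by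
    intro i k hik
    rw [abs_le]
    rcases lt_or_gt_of_ne hik with h | h
    · have := hσ i k h; constructor <;> linarith
    · rw [overlap_comm]; have := hσ k i h; constructor <;> linarith
  have hgram : ∑ j, (∑ i, x i * toVec (σ i) j) ^ 2 =
      n * ∑ i, ∑ k, x i * x k * overlap (σ i) (σ k) := by
    simp_rw [sq, Finset.sum_mul_sum]
    rw [Finset.sum_comm, Finset.mul_sum]
    refine Finset.sum_congr rfl fun i _ => ?_
    rw [Finset.sum_comm, Finset.mul_sum]
    refine Finset.sum_congr rfl fun k _ => ?_
    rw [overlap, dotProduct, Finset.mul_sum, Finset.mul_sum, Finset.mul_sum]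
    refine Finset.sum_congr rfl fun j _ => ?_
    field_simp
  -- Entrywise comparison with `β J + (1 - β) I`. The error form is at most `η (∑ |x i|) ^ 2 ≤ η m ∑
  -- x i ^ 2`, which uses up half of `1 - β`; the part `β J` is nonnegative and is dropped.
  have hterm : ∀ i k : Fin m, x i * x k * β + (if i = k then (1 - β) * x i ^ 2 else 0)
      - η * (|x i| * |x k|) ≤ x i * x k * overlap (σ i) (σ k) := by
    intro i k
    split_ifs with h
    · subst h
      rw [overlap_self hn]
      nlinarith [mul_nonneg hη (mul_nonneg (abs_nonneg (x i)) (abs_nonneg (x i)))]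
    · have h1 : |x i * x k * (overlap (σ i) (σ k) - β)| ≤ η * (|x i| * |x k|) := by
        rw [abs_mul, abs_mul, mul_comm]
        exact mul_le_mul_of_nonneg_right (hne i k h) (by positivity)
      have := (abs_le.1 h1).1
      linarith
  have hsum := Finset.sum_le_sum fun i (_ : i ∈ Finset.univ) =>
    Finset.sum_le_sum fun k (_ : k ∈ Finset.univ) => hterm i k
  have hL : ∑ i, ∑ k, (x i * x k * β + (if i = k then (1 - β) * x i ^ 2 else 0)
      - η * (|x i| * |x k|)) =
      β * (∑ i, x i) ^ 2 + (1 - β) * ∑ i, x i ^ 2 - η * (∑ i, |x i|) ^ 2 := by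
    simp_rw [sq (∑ i, _), Finset.sum_mul_sum, Finset.mul_sum]
    simp only [Finset.sum_sub_distrib, Finset.sum_add_distrib, Finset.sum_ite_eq,
      Finset.mem_univ, if_true, mul_comm β]
  rw [hL] at hsum
  have hcs : (∑ i, |x i|) ^ 2 ≤ m * ∑ i, x i ^ 2 := by
    have := sq_sum_le_card_mul_sum_sq (s := (Finset.univ : Finset (Fin m))) (f := fun i => |x i|)
    simpa using this
  have hS0 : 0 ≤ ∑ i, x i ^ 2 := Finset.sum_nonneg fun i _ => sq_nonneg _
  have key : (1 - β) / 2 * ∑ i, x i ^ 2 ≤ ∑ i, ∑ k, x i * x k * overlap (σ i) (σ k) := by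
    have a1 : η * (∑ i, |x i|) ^ 2 ≤ (1 - β) / 2 * ∑ i, x i ^ 2 := by
      calc η * (∑ i, |x i|) ^ 2 ≤ η * (m * ∑ i, x i ^ 2) := by gcongr
        _ = (η * m) * ∑ i, x i ^ 2 := by ring
        _ ≤ _ := by gcongr
    have a2 : 0 ≤ β * (∑ i, x i) ^ 2 := by positivity
    linarith
  rw [hgram]
  calc (1 - β) / 2 * n * ∑ i, x i ^ 2 = n * ((1 - β) / 2 * ∑ i, x i ^ 2) := by ring
    _ ≤ _ := by gcongr

/-- The covariance form of the interpolated projections is bounded below. -/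
lemma interp_form_ge {n m : ℕ} (hn : 0 < n) {β η : ℝ} (hβ : 0 ≤ β) (hη : 0 ≤ η)
    (hw : η * m ≤ (1 - β) / 2) (σ : Fin m → Cube n) (τ : Fin m → ℝ)
    (hσ : (∀ i j : Fin m, i < j → β - η ≤ overlap (σ i) (σ j) ∧ overlap (σ i) (σ j) ≤ β) ∨
      ∀ i, Real.cos (τ i) = 0)
    (y : Fin m → ℝ) :
    (1 - β) / 2 * n * ∑ i, y i ^ 2 ≤
      ∑ j, (∑ i, y i * Real.cos (τ i) * toVec (σ i) j) ^ 2 +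
        ∑ i, ∑ j, (y i * Real.sin (τ i) * toVec (σ i) j) ^ 2 := by
  have h2 : ∑ i, ∑ j, (y i * Real.sin (τ i) * toVec (σ i) j) ^ 2 =
      n * ∑ i, y i ^ 2 * Real.sin (τ i) ^ 2 := by
    simp [mul_pow, toVec_sq, Finset.mul_sum]
  -- Only the contribution of the shared matrix involves overlaps, and it vanishes when all cosines
  -- do. The private matrices contribute a diagonal form.
  have h1 : (1 - β) / 2 * n * ∑ i, (y i * Real.cos (τ i)) ^ 2 ≤
      ∑ j, (∑ i, y i * Real.cos (τ i) * toVec (σ i) j) ^ 2 := by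
    rcases hσ with h | h
    · exact gram_form_ge hn hβ hη hw σ h _
    · simp [h]
  have h3 : ∑ i, y i ^ 2 = ∑ i, (y i * Real.cos (τ i)) ^ 2 +
      ∑ i, y i ^ 2 * Real.sin (τ i) ^ 2 := by
    rw [← Finset.sum_add_distrib]
    refine Finset.sum_congr rfl fun i _ => ?_
    rw [mul_pow, ← mul_add, Real.cos_sq_add_sin_sq, mul_one]
  have h4 : 0 ≤ n * ∑ i, y i ^ 2 * Real.sin (τ i) ^ 2 :=
    mul_nonneg (by positivity) (Finset.sum_nonneg fun i _ => by positivity)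
  rw [h2, h3]
  nlinarith

/-! ### Gaussian characteristic functions and small ball probabilities -/

instance (M n : ℕ) : IsProbabilityMeasure (gaussianMatrix M n) :=
  inferInstanceAs (IsProbabilityMeasure
    (Measure.pi fun _ : Fin M => Measure.pi fun _ : Fin n => gaussianReal 0 1))

lemma integral_exp_gaussianReal (t : ℝ) :
    ∫ x, Complex.exp (((t * x : ℝ) : ℂ) * Complex.I) ∂(gaussianReal 0 1) =
      (Real.exp (-(t ^ 2) / 2) : ℂ) := by
  have := charFun_gaussianReal (μ := 0) (v := 1) t
  rw [charFun_apply_real] at this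
  push_cast
  rw [this]
  congr 1
  simp; ring

lemma integral_exp_sq_gaussianReal {a : ℝ} (ha : 0 ≤ a) :
    ∫ x, Real.exp (-(a * x ^ 2) / 2) ∂(gaussianReal 0 1) = (√(1 + a))⁻¹ := by
  rw [integral_gaussianReal_eq_integral_smul one_ne_zero]
  simp only [gaussianPDFReal, NNReal.coe_one, mul_one, sub_zero, smul_eq_mul]
  have : ∀ x : ℝ, (√(2 * Real.pi))⁻¹ * Real.exp (-x ^ 2 / 2) * Real.exp (-(a * x ^ 2) / 2) =
      (√(2 * Real.pi))⁻¹ * Real.exp (-((1 + a) / 2) * x ^ 2) := by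
    intro x
    rw [mul_assoc, ← Real.exp_add]
    congr 2; ring
  simp_rw [this]
  rw [integral_const_mul, integral_gaussian, ← Real.sqrt_inv, ← Real.sqrt_inv,
    ← Real.sqrt_mul (by positivity)]
  congr 1
  have := Real.pi_pos
  field_simp

/-- The characteristic function of a product of centred Gaussian laws, in factorized form. -/
lemma integral_exp_pi {ι : Type*} [Fintype ι] {E : ι → Type*} [∀ i, MeasurableSpace (E i)]
    (μ : ∀ i, Measure (E i)) [∀ i, SigmaFinite (μ i)] (f : ∀ i, E i → ℝ) (s : ι → ℝ)
    (h : ∀ i, ∫ x, Complex.exp ((f i x : ℂ) * Complex.I) ∂(μ i) = (Real.exp (-(s i) / 2) : ℂ)) :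
    ∫ x, Complex.exp (((∑ i, f i (x i) : ℝ) : ℂ) * Complex.I) ∂(Measure.pi μ) =
      (Real.exp (-(∑ i, s i) / 2) : ℂ) := by
  have h1 : ∀ x : ∀ i, E i, Complex.exp (((∑ i, f i (x i) : ℝ) : ℂ) * Complex.I) =
      ∏ i, Complex.exp ((f i (x i) : ℂ) * Complex.I) := by
    intro x
    rw [← Complex.exp_sum, Complex.ofReal_sum, Finset.sum_mul]
  simp_rw [h1]
  rw [integral_fintype_prod_eq_prod (f := fun i x => Complex.exp ((f i x : ℂ) * Complex.I))]
  simp_rw [h]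
  rw [← Complex.ofReal_prod, ← Real.exp_sum]
  congr 2
  rw [← Finset.sum_neg_distrib, Finset.sum_div]

lemma integral_exp_gaussianMatrix {M n : ℕ} (a : Fin M → Fin n → ℝ) :
    ∫ X, Complex.exp (((∑ i, ∑ j, a i j * X i j : ℝ) : ℂ) * Complex.I) ∂(gaussianMatrix M n) =
      (Real.exp (-(∑ i, ∑ j, a i j ^ 2) / 2) : ℂ) :=
  integral_exp_pi (fun _ : Fin M => Measure.pi fun _ : Fin n => gaussianReal 0 1)
    (fun i x => ∑ j, a i j * x j) (fun i => ∑ j, a i j ^ 2) fun i =>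
      integral_exp_pi (fun _ : Fin n => gaussianReal 0 1) (fun j x => a i j * x)
        (fun j => a i j ^ 2) fun j => integral_exp_gaussianReal (a i j)

lemma integral_exp_gaussianMatrices {k M n : ℕ} (a : Fin k → Fin M → Fin n → ℝ) :
    ∫ G, Complex.exp (((∑ l, ∑ i, ∑ j, a l i j * G l i j : ℝ) : ℂ) * Complex.I)
        ∂(Measure.pi fun _ : Fin k => gaussianMatrix M n) =
      (Real.exp (-(∑ l, ∑ i, ∑ j, a l i j ^ 2) / 2) : ℂ) :=
  integral_exp_pi (fun _ : Fin k => gaussianMatrix M n)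
    (fun l X => ∑ i, ∑ j, a l i j * X i j) (fun l => ∑ i, ∑ j, a l i j ^ 2)
      fun l => integral_exp_gaussianMatrix (a l)

/-- A random vector whose characteristic function is dominated by that of a centred Gaussian of
covariance `v • 1` has Gaussian small ball probabilities. -/
lemma small_ball_of_charFun_le {α ι : Type*} [MeasurableSpace α] [Fintype ι] (μ : Measure α)
    [IsProbabilityMeasure μ] (Z : α → ι → ℝ) (hZ : Measurable Z) {v K : ℝ} (hv : 0 < v)
    (hK : 0 < K)
    (h : ∀ ξ : ι → ℝ, ‖∫ x, Complex.exp (((∑ i, ξ i * Z x i : ℝ) : ℂ) * Complex.I) ∂μ‖ ≤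
      Real.exp (-(v * ∑ i, ξ i ^ 2) / 2)) :
    μ.real {x | ∀ i, |Z x i| ≤ K} ≤ √(Real.exp 1 * K ^ 2 / v) ^ Fintype.card ι := by
  classical
  let γ : Measure (ι → ℝ) := Measure.pi fun _ : ι => gaussianReal 0 1
  -- On the box the Gaussian weight `F` is at least `exp (-d / 2)`, with `d` the number of
  -- coordinates, so it suffices to bound its mean. `F` is itself a Gaussian characteristic function
  -- evaluated at `Z / K`; after Fubini the hypothesis on the characteristic function of `Z`
  -- applies, and no density or determinant is needed.
  let F : α → ℝ := fun x => Real.exp (-(∑ i, (Z x i / K) ^ 2) / 2)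
  have hmeasF : Measurable F := by fun_prop
  have hF1 : ∀ x, ‖F x‖ ≤ 1 := fun x => by
    rw [Real.norm_eq_abs, abs_of_pos (Real.exp_pos _), Real.exp_le_one_iff]
    have : 0 ≤ ∑ i, (Z x i / K) ^ 2 := Finset.sum_nonneg fun i _ => sq_nonneg _
    linarith
  have hFint : Integrable F μ :=
    Integrable.of_bound hmeasF.aestronglyMeasurable 1 (Filter.Eventually.of_forall hF1)
  have hFξ : ∀ x, (F x : ℂ) =
      ∫ ξ, Complex.exp (((∑ i, ξ i / K * Z x i : ℝ) : ℂ) * Complex.I) ∂γ := by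
    intro x
    rw [← integral_exp_pi (fun _ : ι => gaussianReal 0 1) (fun i y => Z x i / K * y)
      (fun i => (Z x i / K) ^ 2) fun i => integral_exp_gaussianReal _]
    congr with ξ
    congr 3
    exact Finset.sum_congr rfl fun i _ => by ring
  have hbound : ∫ x, F x ∂μ ≤ (√(K ^ 2 / v)) ^ Fintype.card ι := by
    have e1 : ((∫ x, F x ∂μ : ℝ) : ℂ) =
        ∫ ξ, ∫ x, Complex.exp (((∑ i, ξ i / K * Z x i : ℝ) : ℂ) * Complex.I) ∂μ ∂γ := by
      rw [← integral_complex_ofReal]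
      simp_rw [hFξ]
      refine integral_integral_swap ?_
      refine Integrable.of_bound (C := 1) (Measurable.aestronglyMeasurable ?_)
        (Filter.Eventually.of_forall fun p => ?_)
      · simp only [Function.uncurry_def]
        fun_prop
      · simp only [Function.uncurry_def]
        rw [Complex.norm_exp_ofReal_mul_I]
    have e2 : ‖((∫ x, F x ∂μ : ℝ) : ℂ)‖ ≤
        ∫ ξ, ∏ i, Real.exp (-(v / K ^ 2 * ξ i ^ 2) / 2) ∂γ := by
      rw [e1]
      refine norm_integral_le_of_norm_le ?_ (Filter.Eventually.of_forall fun ξ => ?_)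
      · refine Integrable.of_bound (C := 1) (Measurable.aestronglyMeasurable (by fun_prop))
          (Filter.Eventually.of_forall fun ξ => ?_)
        rw [norm_prod]
        refine Finset.prod_le_one (fun i _ => norm_nonneg _) fun i _ => ?_
        rw [Real.norm_eq_abs, abs_of_pos (Real.exp_pos _), Real.exp_le_one_iff]
        have : 0 ≤ v / K ^ 2 * ξ i ^ 2 := by positivity
        linarith
      · refine (h fun i => ξ i / K).trans (le_of_eq ?_)
        rw [← Real.exp_sum, ← Finset.sum_div, Finset.mul_sum, Finset.sum_neg_distrib]
        congr 3
        exact Finset.sum_congr rfl fun i _ => by ring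
    rw [integral_fintype_prod_eq_prod (f := fun (_ : ι) y => Real.exp (-(v / K ^ 2 * y ^ 2) / 2))]
      at e2
    simp_rw [integral_exp_sq_gaussianReal (show 0 ≤ v / K ^ 2 by positivity)] at e2
    rw [Finset.prod_const, Finset.card_univ] at e2
    refine (Real.le_norm_self _).trans ((Complex.norm_real _).symm.le.trans (e2.trans ?_))
    gcongr
    rw [← Real.sqrt_inv]
    apply Real.sqrt_le_sqrt
    rw [← inv_div v]
    gcongr
    linarith
  have hmeas : MeasurableSet {x | ∀ i, |Z x i| ≤ K} := by
    have : {x | ∀ i, |Z x i| ≤ K} = ⋂ i, {x | |Z x i| ≤ K} := by ext; simp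
    rw [this]
    exact MeasurableSet.iInter fun i => measurableSet_le (by fun_prop) measurable_const
  calc μ.real {x | ∀ i, |Z x i| ≤ K}
      = ∫ x, Set.indicator {x | ∀ i, |Z x i| ≤ K} 1 x ∂μ := (integral_indicator_one hmeas).symm
    _ ≤ ∫ x, (√(Real.exp 1)) ^ Fintype.card ι * F x ∂μ := by
        refine integral_mono ((integrable_const 1).indicator hmeas) (hFint.const_mul _) fun x => ?_
        by_cases hx : x ∈ {x | ∀ i, |Z x i| ≤ K}
        · rw [Set.indicator_of_mem hx, Real.sqrt_eq_rpow, ← Real.exp_mul, ← Real.exp_nat_mul,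
            ← Real.exp_add]
          refine Real.one_le_exp ?_
          have : ∑ i, (Z x i / K) ^ 2 ≤ Fintype.card ι := by
            rw [← nsmul_one, ← Finset.card_univ]
            refine Finset.sum_le_card_nsmul _ _ _ fun i _ => ?_
            rw [sq_le_one_iff_abs_le_one, abs_div, abs_of_pos hK, div_le_one hK]
            exact hx i
          linarith
        · rw [Set.indicator_of_notMem hx]
          positivity
    _ ≤ (√(Real.exp 1)) ^ Fintype.card ι * (√(K ^ 2 / v)) ^ Fintype.card ι := by
        rw [integral_const_mul]
        gcongr
    _ = _ := by
        rw [← mul_pow, ← Real.sqrt_mul (by positivity), mul_div_assoc]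

/-- The small ball estimate for the interpolated projections. -/
lemma prob_interp_disc_le {M n m : ℕ} (σ : Fin m → Cube n) (τ : Fin m → ℝ) {v K : ℝ} (hv : 0 < v)
    (hK : 0 < K)
    (hform : ∀ y : Fin m → ℝ, v * ∑ i, y i ^ 2 ≤
      ∑ j, (∑ i, y i * Real.cos (τ i) * toVec (σ i) j) ^ 2 +
        ∑ i, ∑ j, (y i * Real.sin (τ i) * toVec (σ i) j) ^ 2) :
    (Measure.pi fun _ : Fin (m + 1) => gaussianMatrix M n).real
      {G | ∀ i, disc (interp G i (τ i)) (σ i) ≤ K} ≤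
      √(Real.exp 1 * K ^ 2 / v) ^ (m * M) := by
  let Z : (Fin (m + 1) → Matrix (Fin M) (Fin n) ℝ) → Fin m × Fin M → ℝ := fun G p =>
    ∑ j, (Real.cos (τ p.1) * G 0 p.2 j + Real.sin (τ p.1) * G p.1.succ p.2 j) * toVec (σ p.1) j
  have hent : ∀ (l : Fin (m + 1)) (a : Fin M) (j : Fin n),
      Measurable fun G : Fin (m + 1) → Matrix (Fin M) (Fin n) ℝ => G l a j := fun l a j =>
    (measurable_pi_apply j).comp ((measurable_pi_apply a).comp (measurable_pi_apply l))
  have hZ : Measurable Z := by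
    refine measurable_pi_lambda _ fun p => Finset.measurable_sum _ fun j _ => ?_
    exact (((hent _ _ _).const_mul _).add ((hent _ _ _).const_mul _)).mul_const _
  have hset : {G : Fin (m + 1) → Matrix (Fin M) (Fin n) ℝ |
      ∀ i, disc (interp G i (τ i)) (σ i) ≤ K} = {G | ∀ p, |Z G p| ≤ K} := by
    ext G
    simp only [Set.mem_ofPred_eq, disc, pi_norm_le_iff_of_nonneg hK.le, Prod.forall, Z,
      Real.norm_eq_abs]
    rfl
  have hcard : m * M = Fintype.card (Fin m × Fin M) := by simp
  rw [hset, hcard]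
  refine small_ball_of_charFun_le _ Z hZ hv hK fun ξ => ?_
  -- Coefficients of `∑ p, ξ p * Z G p` as a linear form in the matrix entries. Distinct rows use
  -- distinct entries, so the sum of their squares splits over rows, and `hform` applies to each
  -- row.
  let a : Fin (m + 1) → Fin M → Fin n → ℝ := Fin.cons
    (fun r j => ∑ i, ξ (i, r) * Real.cos (τ i) * toVec (σ i) j)
    (fun i r j => ξ (i, r) * Real.sin (τ i) * toVec (σ i) j)
  have hlin : ∀ G, ∑ p, ξ p * Z G p = ∑ l, ∑ r, ∑ j, a l r j * G l r j := by
    intro G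
    rw [Fin.sum_univ_succ, Fintype.sum_prod_type]
    simp only [a, Fin.cons_zero, Fin.cons_succ, Z, Finset.sum_mul, Finset.mul_sum]
    have : ∑ r, ∑ j, ∑ i, ξ (i, r) * Real.cos (τ i) * toVec (σ i) j * G 0 r j =
        ∑ i, ∑ r, ∑ j, ξ (i, r) * Real.cos (τ i) * toVec (σ i) j * G 0 r j := by
      rw [Finset.sum_comm (s := (Finset.univ : Finset (Fin m)))]
      exact Finset.sum_congr rfl fun r _ => Finset.sum_comm
    rw [this, ← Finset.sum_add_distrib]
    refine Finset.sum_congr rfl fun i _ => ?_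
    rw [← Finset.sum_add_distrib]
    refine Finset.sum_congr rfl fun r _ => ?_
    rw [← Finset.sum_add_distrib]
    refine Finset.sum_congr rfl fun j _ => ?_
    ring
  simp_rw [hlin]
  rw [integral_exp_gaussianMatrices, Complex.norm_real, Real.norm_eq_abs,
    abs_of_pos (Real.exp_pos _), Real.exp_le_exp]
  have hq : v * ∑ p, ξ p ^ 2 ≤ ∑ l, ∑ r, ∑ j, a l r j ^ 2 := by
    rw [Fin.sum_univ_succ, Fintype.sum_prod_type_right, Finset.mul_sum]
    simp only [a, Fin.cons_zero, Fin.cons_succ]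
    rw [Finset.sum_comm (s := (Finset.univ : Finset (Fin m))), ← Finset.sum_add_distrib]
    exact Finset.sum_le_sum fun r _ => hform fun i => ξ (i, r)
  linarith

/-! ### First moment bounds in the regime -/

/-- First moment bound for the existence of a tuple with prescribed overlaps all of whose members
have small discrepancy, at fixed angles. -/
lemma prob_exists_tuple_le {M n m : ℕ} (hn : 0 < n) (hm : 1 ≤ m) {K β η : ℝ} (hK : 0 < K)
    (hβ : 1 / 2 < β) (hβ1 : β < 1) (hη : 0 ≤ η) (hw : η * m ≤ (1 - β) / 2) (τ : Fin m → ℝ) :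
    (Measure.pi fun _ : Fin (m + 1) => gaussianMatrix M n).real
      {G | ∃ σ : Fin m → Cube n, (∀ i j : Fin m, i < j → β - η ≤ overlap (σ i) (σ j)) ∧
        ((∀ i j : Fin m, i < j → overlap (σ i) (σ j) ≤ β) ∨ ∀ i, Real.cos (τ i) = 0) ∧
        ∀ i, disc (interp G i (τ i)) (σ i) ≤ K} ≤
      (2 : ℝ) ^ (n * (1 + (m - 1) * entropy2 (1 - β))) *
        √(Real.exp 1 * K ^ 2 / ((1 - β) / 2 * n)) ^ (m * M) := by
  classical
  have hn' : (0 : ℝ) < n := by positivity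
  have hη' : η ≤ (1 - β) / 2 := by
    have : (1 : ℝ) ≤ m := by exact_mod_cast hm
    nlinarith
  let S : Finset (Fin m → Cube n) := Finset.univ.filter fun σ =>
    (∀ i j : Fin m, i < j → β - η ≤ overlap (σ i) (σ j)) ∧
      ((∀ i j : Fin m, i < j → overlap (σ i) (σ j) ≤ β) ∨ ∀ i, Real.cos (τ i) = 0)
  have hcard : (S.card : ℝ) ≤ (2 : ℝ) ^ (n * (1 + (m - 1) * entropy2 (1 - β))) := by
    obtain ⟨k, rfl⟩ : ∃ k, m = k + 1 := ⟨m - 1, by omega⟩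
    have := card_tuples_le (n := n) (p := 1 - β) (by linarith) (by linarith) S fun σ hσ i => by
      have h1 := (Finset.mem_filter.1 hσ).2.1 0 i.succ (Fin.succ_pos i)
      rw [overlap_eq hn] at h1
      have h2 : 2 * (hammingDist (σ 0) (σ i.succ) : ℝ) / n ≤ 2 * (1 - β) := by linarith
      rw [div_le_iff₀ hn'] at h2
      linarith
    simpa using this
  have hsub : {G : Fin (m + 1) → Matrix (Fin M) (Fin n) ℝ |
      ∃ σ : Fin m → Cube n, (∀ i j : Fin m, i < j → β - η ≤ overlap (σ i) (σ j)) ∧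
        ((∀ i j : Fin m, i < j → overlap (σ i) (σ j) ≤ β) ∨ ∀ i, Real.cos (τ i) = 0) ∧
        ∀ i, disc (interp G i (τ i)) (σ i) ≤ K} ⊆
      ⋃ σ ∈ S, {G | ∀ i, disc (interp G i (τ i)) (σ i) ≤ K} := by
    rintro G ⟨σ, h1, h2, h3⟩
    simp only [Set.mem_iUnion]
    exact ⟨σ, Finset.mem_filter.2 ⟨Finset.mem_univ _, h1, h2⟩, h3⟩
  refine (measureReal_mono hsub (measure_ne_top _ _)).trans ((measureReal_biUnion_finset_le _ _).trans ?_)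
  refine (Finset.sum_le_card_nsmul S _
    (√(Real.exp 1 * K ^ 2 / ((1 - β) / 2 * n)) ^ (m * M)) fun σ hσ => ?_).trans ?_
  · have hσ' := (Finset.mem_filter.1 hσ).2
    refine prob_interp_disc_le σ τ (mul_pos (by linarith) hn') hK fun y =>
      interp_form_ge hn (by linarith) hη hw σ τ ?_ y
    exact hσ'.2.imp (fun h i j hij => ⟨hσ'.1 i j hij, h i j hij⟩) id
  · rw [nsmul_eq_mul]
    gcongr

lemma logb_two_natCast_le (M : ℕ) : Real.logb 2 M ≤ M := by
  rcases Nat.eq_zero_or_pos M with rfl | h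
  · simp
  · rw [Real.logb_le_iff_le_rpow (by norm_num) (by exact_mod_cast h), Real.rpow_natCast]
    exact_mod_cast Nat.lt_two_pow_self.le

/-- In the regime `n ≍ M log M`, the number of rows tends to infinity with `n`. -/
lemma Regime.rows_gt {C₁ c₂ : ℝ} (hC : 0 < C₁) {M n : ℕ} (h : Regime C₁ c₂ M n) {D : ℝ}
    (hn : C₁ * D ^ 2 < n) : D < M := by
  by_contra! hM
  have h1 : (n : ℝ) ≤ C₁ * M * M := h.1.trans (by
    have := logb_two_natCast_le M
    gcongr)
  have h2 : C₁ * M * M ≤ C₁ * D ^ 2 := by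
    rw [mul_assoc, ← sq]
    gcongr
  linarith

/-- In the regime, the small ball probability of an `m × M` array is at most
`2 ^ (- m n / (2 C₁))`. -/
lemma small_ball_factor_le {C₁ c₂ : ℝ} (hC : 0 < C₁) (hc₂ : 0 < c₂) {B : ℝ} {M n : ℕ}
    (h : Regime C₁ c₂ M n) (hn0 : 0 < n) (hn : C₁ * ((2 : ℝ) ^ (B / c₂)) ^ 2 < n) (m : ℕ) :
    √(B / n) ^ (m * M) ≤ (2 : ℝ) ^ (-(m * n / (2 * C₁) : ℝ)) := by
  have hD : (2 : ℝ) ^ (B / c₂) < M := h.rows_gt hC hn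
  have hM : (0 : ℝ) < M := lt_trans (by positivity) hD
  have hn' : (0 : ℝ) < n := by exact_mod_cast hn0
  have hlog : B / c₂ ≤ Real.logb 2 M :=
    (Real.le_logb_iff_rpow_le (by norm_num) hM).2 hD.le
  -- Once `log₂ M ≥ B / c₂`, the lower bound of the regime gives `n ≥ B M`. The product is then at
  -- most `M ^ (-m M / 2)`, and the upper bound of the regime turns `M log₂ M` into `n / C₁`.
  have hBM : B / n ≤ (M : ℝ)⁻¹ := by
    rw [div_le_iff₀ hn', inv_mul_eq_div, le_div_iff₀ hM]
    rw [div_le_iff₀ hc₂] at hlog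
    refine le_trans ?_ h.2
    nlinarith
  calc √(B / n) ^ (m * M) ≤ √((M : ℝ)⁻¹) ^ (m * M) := by gcongr
    _ = (2 : ℝ) ^ (-(m * (M * Real.logb 2 M) / 2) : ℝ) := by
        have e : (M : ℝ) = (2 : ℝ) ^ Real.logb 2 M :=
          (Real.rpow_logb (by norm_num) (by norm_num) hM).symm
        rw [Real.sqrt_eq_rpow, ← Real.rpow_natCast, ← Real.rpow_mul (by positivity),
          ← Real.rpow_neg_one, ← Real.rpow_mul (by positivity)]
        conv_lhs => rw [e]
        rw [← Real.rpow_mul zero_le_two]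
        congr 1
        push_cast
        ring
    _ ≤ _ := by
        refine Real.rpow_le_rpow_of_exponent_le (by norm_num) (neg_le_neg ?_)
        have : (n : ℝ) / C₁ ≤ M * Real.logb 2 M := by
          rw [div_le_iff₀ hC]
          have := h.1
          linarith
        calc (m * n / (2 * C₁) : ℝ) = m * (n / C₁) / 2 := by field_simp
          _ ≤ _ := by gcongr

/-- At fixed angles, forbidden tuples exist with probability at most `2 ^ (-3 n)`. -/
lemma exists_forall_prob_exists_tuple_le {K C₁ c₂ β η : ℝ} {m : ℕ} (hK : 0 < K) (hc₂ : 0 < c₂)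
    (hC : 0 < C₁) (hm : 1 ≤ m) (hmC : 16 * C₁ ≤ m) (hβ : 1 / 2 < β) (hβ1 : β < 1)
    (hent : entropy2 (1 - β) ≤ 1 / (4 * C₁)) (hη : 0 ≤ η) (hw : η * m ≤ (1 - β) / 2) :
    ∃ n₀ : ℕ, 0 < n₀ ∧ ∀ n : ℕ, n₀ ≤ n → ∀ M : ℕ, Regime C₁ c₂ M n → ∀ τ : Fin m → ℝ,
      (Measure.pi fun _ : Fin (m + 1) => gaussianMatrix M n).real
        {G | ∃ σ : Fin m → Cube n, (∀ i j : Fin m, i < j → β - η ≤ overlap (σ i) (σ j)) ∧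
          ((∀ i j : Fin m, i < j → overlap (σ i) (σ j) ≤ β) ∨ ∀ i, Real.cos (τ i) = 0) ∧
          ∀ i, disc (interp G i (τ i)) (σ i) ≤ K} ≤ (2 : ℝ) ^ (-(3 * n : ℝ)) := by
  set B := Real.exp 1 * K ^ 2 / ((1 - β) / 2) with hB
  obtain ⟨N, hN⟩ := exists_nat_gt (C₁ * ((2 : ℝ) ^ (B / c₂)) ^ 2)
  refine ⟨N + 1, N.succ_pos, fun n hn M hreg τ => ?_⟩
  have hn0 : 0 < n := by omega
  have hNn : (N : ℝ) ≤ n := by exact_mod_cast (by omega : N ≤ n)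
  refine (prob_exists_tuple_le hn0 hm hK hβ hβ1 hη hw τ).trans ?_
  rw [← div_div, ← hB]
  refine (mul_le_mul_of_nonneg_left (small_ball_factor_le hC hc₂ hreg hn0 (hN.trans_le hNn) m)
    (by positivity)).trans ?_
  rw [← Real.rpow_add (by norm_num)]
  refine Real.rpow_le_rpow_of_exponent_le (by norm_num) ?_
  have hm' : (1 : ℝ) ≤ m := by exact_mod_cast hm
  have h1 : ((m : ℝ) - 1) * entropy2 (1 - β) ≤ (m - 1) * (1 / (4 * C₁)) :=
    mul_le_mul_of_nonneg_left hent (by linarith)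
  have h2 : (4 : ℝ) ≤ m * (1 / (4 * C₁)) := by
    rw [mul_one_div, le_div_iff₀ (by positivity)]
    linarith
  have h3 : (m : ℝ) * n / (2 * C₁) = n * (2 * (m * (1 / (4 * C₁)))) := by
    field_simp; ring
  have h4 : 0 < 1 / (4 * C₁) := by positivity
  rw [h3]
  -- The exponent per unit of `n` is at most `1 + (m - 1) / (4 C₁) - m / (2 C₁) ≤ 1 - m / (4 C₁)`,
  -- and `m ≥ 16 C₁`.
  have h5 : 1 + ((m : ℝ) - 1) * entropy2 (1 - β) - 2 * (m * (1 / (4 * C₁))) ≤ -3 := by linarith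
  have h6 := mul_le_mul_of_nonneg_left h5 (Nat.cast_nonneg n : (0 : ℝ) ≤ n)
  linarith

/-- Union bound over the angle tuples: with `c = 1 / m` there are at most `2 ^ n` of them, each
costing `2 ^ (-3 n)`, which leaves `δ = 2`. -/
theorem ensembleOGP {K C₁ c₂ β η : ℝ} {m : ℕ} (hK : 0 < K) (hc₂ : 0 < c₂)
    (hC : 0 < C₁) (hm : 1 ≤ m) (hmC : 16 * C₁ ≤ m) (hβ : 1 / 2 < β) (hβ1 : β < 1)
    (hent : entropy2 (1 - β) ≤ 1 / (4 * C₁)) (hη : 0 ≤ η) (hw : η * m ≤ (1 - β) / 2) :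
    EnsembleOGP K C₁ c₂ m β η := by
  classical
  have hm' : (0 : ℝ) < m := by exact_mod_cast hm
  obtain ⟨n₀, -, h⟩ := exists_forall_prob_exists_tuple_le hK hc₂ hC hm hmC hβ hβ1 hent hη hw
  refine ⟨1 / m, by positivity, 2, by norm_num, n₀, fun n hn M hreg I _ hI => ?_⟩
  have hsub : {G : Fin (m + 1) → Matrix (Fin M) (Fin n) ℝ | (ogpSet K β η I G).Nonempty} ⊆
      ⋃ τ ∈ Fintype.piFinset fun _ : Fin m => I,
        {G | ∃ σ : Fin m → Cube n, (∀ i j : Fin m, i < j → β - η ≤ overlap (σ i) (σ j)) ∧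
          ((∀ i j : Fin m, i < j → overlap (σ i) (σ j) ≤ β) ∨ ∀ i, Real.cos (τ i) = 0) ∧
          ∀ i, disc (interp G i (τ i)) (σ i) ≤ K} := by
    rintro G ⟨σ, h1, τ, h2⟩
    simp only [Set.mem_iUnion]
    exact ⟨τ, Fintype.mem_piFinset.2 fun i => (h2 i).1, σ, fun i j hij => (h1 i j hij).1,
      Or.inl fun i j hij => (h1 i j hij).2, fun i => (h2 i).2⟩
  refine (measureReal_mono hsub (measure_ne_top _ _)).trans ((measureReal_biUnion_finset_le _ _).trans ?_)
  refine (Finset.sum_le_card_nsmul _ _ _ fun τ _ => h n hn M hreg τ).trans ?_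
  rw [nsmul_eq_mul, Fintype.card_piFinset, Finset.prod_const, Finset.card_univ, Fintype.card_fin]
  push_cast
  calc (I.card : ℝ) ^ m * (2 : ℝ) ^ (-(3 * n : ℝ))
      ≤ ((2 : ℝ) ^ (1 / m * n : ℝ)) ^ m * (2 : ℝ) ^ (-(3 * n : ℝ)) := by gcongr
    _ = (2 : ℝ) ^ (-(2 * n : ℝ)) := by
        rw [← Real.rpow_natCast, ← Real.rpow_mul zero_le_two, ← Real.rpow_add (by norm_num)]
        congr 1
        field_simp
        ring

/-! ### Ramsey's theorem and forbidden tuples of paths -/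

/-- In a large enough set there is a long sequence in which the colour of a pair depends only on
its first member. -/
lemma exists_prehomogeneous (κ : Type*) [Fintype κ] (s : ℕ) :
    ∃ N : ℕ, ∀ (α : Type) (c : α → α → κ) (V : Finset α), N ≤ V.card →
      ∃ f : Fin s → α, Function.Injective f ∧ (∀ i, f i ∈ V) ∧
        ∃ col : Fin s → κ, ∀ i j, i < j → c (f i) (f j) = col i := by
  classical
  induction s with
  | zero =>
    exact ⟨0, fun α c V _ => ⟨Fin.elim0, fun i => i.elim0, fun i => i.elim0, Fin.elim0,
      fun i => i.elim0⟩⟩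
  | succ s ih =>
    obtain ⟨N, hN⟩ := ih
    refine ⟨Fintype.card κ * N + 1, fun α c V hV => ?_⟩
    obtain ⟨v, hv⟩ : V.Nonempty := Finset.card_pos.1 (by omega)
    obtain ⟨k, -, hk⟩ := Finset.exists_le_card_fiber_of_mul_le_card_of_maps_to
      (s := V.erase v) (t := (Finset.univ : Finset κ)) (f := c v) (n := N) (by simp)
      -- The colour `c v v` only witnesses that `κ` is nonempty, as the pigeonhole principle
      -- requires.
      ⟨c v v, Finset.mem_univ _⟩ (by rw [Finset.card_erase_of_mem hv, Finset.card_univ]; omega)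
    obtain ⟨f, hf, hfV, col, hcol⟩ := hN α c _ hk
    have hmem : ∀ i, f i ≠ v ∧ f i ∈ V ∧ c v (f i) = k := fun i => by
      have := hfV i
      simp only [Finset.mem_filter, Finset.mem_erase] at this
      exact ⟨this.1.1, this.1.2, this.2⟩
    refine ⟨Fin.cons v f, ?_, ?_, Fin.cons k col, ?_⟩
    · rw [Fin.cons_injective_iff]
      exact ⟨fun ⟨i, hi⟩ => (hmem i).1 hi, hf⟩
    · exact fun i => Fin.cases hv (fun i => (hmem i).2.1) i
    · intro i j hij
      obtain ⟨j, rfl⟩ := Fin.exists_succ_eq.2 (Fin.ne_zero_of_lt hij)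
      refine Fin.cases (fun _ => ?_) (fun i hij => ?_) i hij
      · simpa using (hmem j).2.2
      · simpa using hcol i j (Fin.succ_lt_succ_iff.1 hij)

/-- Finite Ramsey theorem for pairs with finitely many colours. -/
theorem exists_monochromatic (κ : Type*) [Fintype κ] (m : ℕ) :
    ∃ R : ℕ, ∀ c : Fin R → Fin R → κ, ∃ ι : Fin m → Fin R, Function.Injective ι ∧
      ∃ k, ∀ i j, i < j → c (ι i) (ι j) = k := by
  classical
  -- The extra term provides an index `0`, whose colour shows that `κ` is nonempty; the rest is
  -- pigeonhole on `col`.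
  obtain ⟨R, hR⟩ := exists_prehomogeneous κ (Fintype.card κ * m + 1)
  refine ⟨R, fun c => ?_⟩
  obtain ⟨f, hf, -, col, hcol⟩ := hR (Fin R) c Finset.univ (by simp)
  obtain ⟨k, -, hk⟩ := Finset.exists_le_card_fiber_of_mul_le_card_of_maps_to
    (s := Finset.univ) (t := (Finset.univ : Finset κ)) (f := col) (n := m) (by simp)
    ⟨col 0, Finset.mem_univ _⟩ (by simp)
  let e := Finset.orderEmbOfCardLe _ hk
  refine ⟨fun i => f (e i), hf.comp e.injective, k, fun i j hij => ?_⟩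
  rw [hcol _ _ (e.strictMono hij)]
  exact (Finset.mem_filter.1 (Finset.orderEmbOfCardLe_mem _ hk i)).2

lemma abs_overlap_sub_le {n : ℕ} (hn : 0 < n) (a b a' b' : Cube n) :
    |overlap a' b' - overlap a b| ≤ 2 * (hammingDist a a' + hammingDist b b') / n := by
  have hn' : (0 : ℝ) < n := by exact_mod_cast hn
  have h1 : hammingDist a b ≤ hammingDist a a' + hammingDist a' b' + hammingDist b b' :=
    (hammingDist_triangle a a' b).trans (by
      have := hammingDist_triangle a' b' b
      rw [hammingDist_comm b' b] at this
      omega)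
  have h2 : hammingDist a' b' ≤ hammingDist a a' + hammingDist a b + hammingDist b b' :=
    (hammingDist_triangle a' a b').trans (by
      have := hammingDist_triangle a b b'
      rw [hammingDist_comm a' a]
      omega)
  have h1' : (hammingDist a b : ℝ) ≤ hammingDist a a' + hammingDist a' b' + hammingDist b b' := by
    exact_mod_cast h1
  have h2' : (hammingDist a' b' : ℝ) ≤ hammingDist a a' + hammingDist a b + hammingDist b b' := by
    exact_mod_cast h2
  rw [overlap_eq hn, overlap_eq hn]
  have : (1 - 2 * hammingDist a' b' / n - (1 - 2 * hammingDist a b / n) : ℝ) =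
      2 * (hammingDist a b - hammingDist a' b') / n := by ring
  rw [this, abs_div, abs_of_pos hn', abs_mul, abs_of_pos (zero_lt_two : (0 : ℝ) < 2)]
  gcongr
  rw [abs_le]
  constructor <;> linarith

/-- A real sequence with small steps cannot jump over an interval. -/
lemma lt_of_small_steps {f : ℕ → ℝ} {β η : ℝ} {Q : ℕ} (h0 : β < f 0)
    (hstep : ∀ k < Q, |f (k + 1) - f k| ≤ η)
    (havoid : ∀ k ≤ Q, ¬ (β - η ≤ f k ∧ f k ≤ β)) : ∀ k ≤ Q, β < f k := by
  intro k
  induction k with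
  | zero => exact fun _ => h0
  | succ k ih =>
    intro hk
    by_contra! hle
    have h1 := (abs_le.1 (hstep k (by omega))).1
    exact havoid _ hk ⟨by linarith [ih (by omega)], hle⟩

/-- Given sufficiently many discrete paths in the cube with a common starting point and small
steps, some `m` of them have at a common time all their overlaps in `[β - η, β]`, or end with
all their overlaps at least `β - η`. -/
lemma exists_forbidden_tuple (m Q : ℕ) :
    ∃ R : ℕ, ∀ (n : ℕ) (β η : ℝ) (σ : Fin R → ℕ → Cube n), 0 < n → β < 1 → 0 ≤ η →
      (∀ i j, σ i 0 = σ j 0) →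
      (∀ i, ∀ k < Q, (hammingDist (σ i k) (σ i (k + 1)) : ℝ) ≤ η / 4 * n) →
      ∃ ι : Fin m → Fin R, Function.Injective ι ∧ ∃ k ≤ Q,
        (∀ i j, i < j → β - η ≤ overlap (σ (ι i) k) (σ (ι j) k)) ∧
        ((∀ i j, i < j → overlap (σ (ι i) k) (σ (ι j) k) ≤ β) ∨ k = Q) := by
  classical
  obtain ⟨R, hR⟩ := exists_monochromatic (Option (Fin (Q + 1))) m
  refine ⟨R, fun n β η σ hn hβ hη h0 hstep => ?_⟩
  let P : Fin R → Fin R → Fin (Q + 1) → Prop := fun i j k =>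
    β - η ≤ overlap (σ i k) (σ j k) ∧ overlap (σ i k) (σ j k) ≤ β
  let c : Fin R → Fin R → Option (Fin (Q + 1)) := fun i j =>
    if h : ∃ k, P i j k then some h.choose else none
  have hsome : ∀ i j k, c i j = some k → P i j k := by
    intro i j k hc
    by_cases h : ∃ k, P i j k
    · rw [show c i j = some h.choose from dif_pos h, Option.some.injEq] at hc
      exact hc ▸ h.choose_spec
    · rw [show c i j = none from dif_neg h] at hc
      cases hc
  have hnone : ∀ i j, c i j = none → β < overlap (σ i Q) (σ j Q) := by
    intro i j hc
    have h : ¬ ∃ k, P i j k := fun h => by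
      rw [show c i j = some h.choose from dif_pos h] at hc
      cases hc
    have hn' : (0 : ℝ) < n := by exact_mod_cast hn
    refine lt_of_small_steps (f := fun k => overlap (σ i k) (σ j k)) (η := η) ?_
      (fun k hk => ?_) (fun k hk hP => h ⟨⟨k, by omega⟩, hP⟩) Q le_rfl
    · simpa only [h0 i j, overlap_self hn] using hβ
    -- Two paths each moving `η n / 4` change the overlap by at most `2 (η / 4 + η / 4) = η`, the
    -- width of the window.
    · refine (abs_overlap_sub_le hn _ _ _ _).trans ?_
      rw [div_le_iff₀ hn']
      linarith [hstep i k hk, hstep j k hk]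
  obtain ⟨ι, hι, k, hk⟩ := hR c
  refine ⟨ι, hι, ?_⟩
  cases k with
  | none =>
    exact ⟨Q, le_rfl, fun i j hij => by linarith [hnone _ _ (hk i j hij)], Or.inr rfl⟩
  | some k =>
    exact ⟨k, by omega, fun i j hij => (hsome _ _ _ (hk i j hij)).1,
      Or.inl fun i j hij => (hsome _ _ _ (hk i j hij)).2⟩

/-! ### Rotation invariance and interpolated pairs -/

/-- The coordinatewise extension of a measure preserving map of pairs to pairs of families. -/
lemma measurePreserving_pi_pair {ι α : Type*} [Fintype ι] [MeasurableSpace α] (μ : Measure α)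
    [SigmaFinite μ] {f : α × α → α × α} (hf : MeasurePreserving f (μ.prod μ) (μ.prod μ)) :
    MeasurePreserving
      (fun p : (ι → α) × (ι → α) => ((fun i => (f (p.1 i, p.2 i)).1, fun i => (f (p.1 i, p.2 i)).2) :
        (ι → α) × (ι → α)))
      ((Measure.pi fun _ => μ).prod (Measure.pi fun _ => μ))
      ((Measure.pi fun _ => μ).prod (Measure.pi fun _ => μ)) :=
  have h := measurePreserving_arrowProdEquivProdArrow α α ι (fun _ => μ) (fun _ => μ)
  (h.comp (measurePreserving_pi (fun _ : ι => μ.prod μ) (fun _ => μ.prod μ) fun _ => hf)).comp h.symm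

/-- Rotation invariance of a pair of independent Gaussian matrices. -/
lemma measurePreserving_rotation_gaussianMatrix (M n : ℕ) (θ : ℝ) :
    MeasurePreserving
      (fun p : Matrix (Fin M) (Fin n) ℝ × Matrix (Fin M) (Fin n) ℝ =>
        (Real.cos θ • p.1 + Real.sin θ • p.2, -Real.sin θ • p.1 + Real.cos θ • p.2))
      ((gaussianMatrix M n).prod (gaussianMatrix M n))
      ((gaussianMatrix M n).prod (gaussianMatrix M n)) := by
  have h1 : MeasurePreserving (ContinuousLinearMap.rotation (E := ℝ) θ)
      ((gaussianReal 0 1).prod (gaussianReal 0 1)) ((gaussianReal 0 1).prod (gaussianReal 0 1)) :=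
    ⟨by fun_prop, IsGaussian.map_rotation_eq_self (by simp) θ⟩
  exact measurePreserving_pi_pair (ι := Fin M) _ (measurePreserving_pi_pair (ι := Fin n) _ h1)

lemma measurable_matrix_iff {α : Type*} [MeasurableSpace α] {M n : ℕ}
    {f : α → Matrix (Fin M) (Fin n) ℝ} : Measurable f ↔ ∀ i j, Measurable fun x => f x i j := by
  refine ⟨fun h i j => (measurable_pi_apply j).comp ((measurable_pi_apply i).comp h), fun h => ?_⟩
  exact measurable_pi_lambda (δ := Fin M) (X := fun _ => Fin n → ℝ) f fun i =>
    measurable_pi_lambda _ fun j => h i j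

lemma measurable_lincomb (M n : ℕ) (a b : ℝ) :
    Measurable fun p : Matrix (Fin M) (Fin n) ℝ × Matrix (Fin M) (Fin n) ℝ =>
      a • p.1 + b • p.2 := by
  refine measurable_matrix_iff.2 fun i j => ?_
  exact ((measurable_matrix_iff.1 measurable_fst i j).const_mul a).add
    ((measurable_matrix_iff.1 measurable_snd i j).const_mul b)

lemma measurePreserving_interp (M n : ℕ) (θ : ℝ) :
    MeasurePreserving
      (fun p : Matrix (Fin M) (Fin n) ℝ × Matrix (Fin M) (Fin n) ℝ =>
        Real.cos θ • p.1 + Real.sin θ • p.2)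
      ((gaussianMatrix M n).prod (gaussianMatrix M n)) (gaussianMatrix M n) :=
  measurePreserving_fst.comp (measurePreserving_rotation_gaussianMatrix M n θ)

/-- By the addition formulas, the matrix at angle `θ + δ` is `cos δ • X' + sin δ • Y'`, where `(X',
Y')` is the pair rotated by `θ`, again independent Gaussian. Thus every step of the path has the law
from the stability condition. -/
lemma measurePreserving_interp_pair (M n : ℕ) (θ : ℝ) {δ : ℝ} (h0 : 0 ≤ δ) (h1 : δ ≤ Real.pi) :
    MeasurePreserving
      (fun p : Matrix (Fin M) (Fin n) ℝ × Matrix (Fin M) (Fin n) ℝ =>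
        (Real.cos θ • p.1 + Real.sin θ • p.2, Real.cos (θ + δ) • p.1 + Real.sin (θ + δ) • p.2))
      ((gaussianMatrix M n).prod (gaussianMatrix M n)) (correlatedPair M n (Real.cos δ)) := by
  have hs : Real.sqrt (1 - Real.cos δ ^ 2) = Real.sin δ := by
    rw [← Real.sin_sq, Real.sqrt_sq (Real.sin_nonneg_of_nonneg_of_le_pi h0 h1)]
  have hm : MeasurePreserving
      (fun p : Matrix (Fin M) (Fin n) ℝ × Matrix (Fin M) (Fin n) ℝ =>
        (p.1, Real.cos δ • p.1 + Real.sqrt (1 - Real.cos δ ^ 2) • p.2))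
      ((gaussianMatrix M n).prod (gaussianMatrix M n)) (correlatedPair M n (Real.cos δ)) :=
    ⟨measurable_fst.prodMk (measurable_lincomb M n _ _), rfl⟩
  convert! hm.comp (measurePreserving_rotation_gaussianMatrix M n θ) using 1
  funext p
  ext i j
  · rfl
  · simp only [Function.comp, hs, Real.cos_add, Real.sin_add, Matrix.add_apply, Matrix.smul_apply,
      smul_eq_mul]
    ring

/-! ### Replicas sharing a matrix and the internal randomness -/

/-- **Jensen** for replicas: conditionally independent copies sharing `b`. -/
lemma pow_le_prob_forall_replicas {B Y : Type*} [MeasurableSpace B] [MeasurableSpace Y]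
    (ν : Measure B) (μ : Measure Y) [IsProbabilityMeasure ν] [IsProbabilityMeasure μ]
    {E : Set (B × Y)} (hE : MeasurableSet E) (R : ℕ) :
    (ν.prod μ).real E ^ R ≤
      (ν.prod (Measure.pi fun _ : Fin R => μ)).real {q | ∀ i, (q.1, q.2 i) ∈ E} := by
  let g : B → ℝ := fun b => μ.real (Prod.mk b ⁻¹' E)
  have hg : Measurable g := (measurable_measure_prodMk_left hE).ennreal_toReal
  have hg1 : ∀ b, ‖g b‖ ≤ 1 := fun b => by
    rw [Real.norm_eq_abs, abs_of_nonneg measureReal_nonneg]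
    exact measureReal_le_one
  have hE' : MeasurableSet {q : B × (Fin R → Y) | ∀ i, (q.1, q.2 i) ∈ E} := by
    have : {q : B × (Fin R → Y) | ∀ i, (q.1, q.2 i) ∈ E} =
        ⋂ i, (fun q : B × (Fin R → Y) => (q.1, q.2 i)) ⁻¹' E := by ext; simp
    rw [this]
    exact MeasurableSet.iInter fun i => hE.preimage (by fun_prop)
  have e1 : (ν.prod μ).real E = ∫ b, g b ∂ν := by
    rw [measureReal_def, Measure.prod_apply hE, ← integral_toReal
      (measurable_measure_prodMk_left hE).aemeasurable
      (Filter.Eventually.of_forall fun b => measure_lt_top _ _)]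
    rfl
  have e2 : (ν.prod (Measure.pi fun _ : Fin R => μ)).real {q | ∀ i, (q.1, q.2 i) ∈ E} =
      -- Given `b` the replicas are independent, so the fibre of the event has measure `g b ^ R`.
      ∫ b, g b ^ R ∂ν := by
    rw [measureReal_def, Measure.prod_apply hE', ← integral_toReal
      (measurable_measure_prodMk_left hE').aemeasurable
      (Filter.Eventually.of_forall fun b => measure_lt_top _ _)]
    congr with b
    have : Prod.mk b ⁻¹' {q : B × (Fin R → Y) | ∀ i, (q.1, q.2 i) ∈ E} =
        Set.univ.pi fun _ : Fin R => Prod.mk b ⁻¹' E := by ext; simp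
    rw [this, Measure.pi_pi]
    simp [g, measureReal_def]
  rw [e1, e2]
  refine (convexOn_pow R).map_integral_le (f := g) (by fun_prop) isClosed_Ici
    (Filter.Eventually.of_forall fun b => measureReal_nonneg) ?_ ?_
  · exact Integrable.of_bound hg.aestronglyMeasurable 1 (Filter.Eventually.of_forall hg1)
  · refine Integrable.of_bound (C := 1) (Measurable.aestronglyMeasurable (by fun_prop))
      (Filter.Eventually.of_forall fun b => ?_)
    simp only [Function.comp, norm_pow]
    exact pow_le_one₀ (norm_nonneg _) (hg1 b)

/-- Selecting `m` distinct replicas yields again independent copies. -/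
lemma measurePreserving_select {α B : Type*} [MeasurableSpace α] [MeasurableSpace B]
    (μ : Measure α) (P : Measure B) [IsProbabilityMeasure μ] [IsProbabilityMeasure P] {m R : ℕ}
    {ι : Fin m → Fin R} (hι : Function.Injective ι) :
    MeasurePreserving (fun q : (α × B) × (Fin R → α) =>
        (Fin.cons q.1.1 fun i => q.2 (ι i) : Fin (m + 1) → α))
      ((μ.prod P).prod (Measure.pi fun _ : Fin R => μ)) (Measure.pi fun _ : Fin (m + 1) => μ) := by
  have h1 : MeasurePreserving (fun y : Fin R → α => fun i => y (ι i))
      (Measure.pi fun _ : Fin R => μ) (Measure.pi fun _ : Fin m => μ) := by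
    refine ⟨by fun_prop, ?_⟩
    have hind : iIndepFun (fun (i : Fin R) (y : Fin R → α) => y i)
        (Measure.pi fun _ : Fin R => μ) :=
      iIndepFun_pi (X := fun _ x => x) fun _ => aemeasurable_id
    rw [(hind.precomp hι).map_fun_eq_pi_map fun i => (measurable_pi_apply _).aemeasurable]
    congr with i : 1
    exact (measurePreserving_eval (fun _ : Fin R => μ) (ι i)).map_eq
  have h2 : MeasurePreserving (Prod.fst : α × B → α) (μ.prod P) μ := measurePreserving_fst
  have h3 := (measurePreserving_piFinSuccAbove (fun _ : Fin (m + 1) => μ) 0).symm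
  convert! h3.comp (h2.prod h1) using 1
  funext q
  exact (Fin.insertNth_zero' _ _).symm

lemma measurePreserving_rearrange {α B : Type*} [MeasurableSpace α] [MeasurableSpace B]
    (μ : Measure α) (P : Measure B) [IsProbabilityMeasure μ] [IsProbabilityMeasure P] :
    MeasurePreserving (fun q : (α × B) × α => ((q.1.1, q.2), q.1.2))
      ((μ.prod P).prod μ) ((μ.prod μ).prod P) :=
  ((measurePreserving_prodAssoc μ μ P).symm.comp
    ((MeasurePreserving.id μ).prod (Measure.measurePreserving_swap (μ := P) (ν := μ)))).comp
    (measurePreserving_prodAssoc μ P μ)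

/-! ### Measurability and Frobenius norms along the path -/

/-- The rotated matrix `cos t • X + sin t • Y`. -/
def rotated {M n : ℕ} (X Y : Matrix (Fin M) (Fin n) ℝ) (t : ℝ) : Matrix (Fin M) (Fin n) ℝ :=
  Real.cos t • X + Real.sin t • Y

lemma measurable_toVec {n : ℕ} (j : Fin n) : Measurable fun σ : Cube n => toVec σ j := by
  have h1 : Measurable (Units.val : ℤˣ → ℤ) := comap_measurable _
  have h2 : Measurable (fun z : ℤ => (z : ℝ)) := measurable_from_top
  exact h2.comp (h1.comp (measurable_pi_apply j))

lemma Measurable.disc {α : Type*} [MeasurableSpace α] {M n : ℕ}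
    {X : α → Matrix (Fin M) (Fin n) ℝ} {σ : α → Cube n} (hX : Measurable X) (hσ : Measurable σ) :
    Measurable fun a => disc (X a) (σ a) := by
  have h : Measurable fun a => Matrix.mulVec (X a) (toVec (σ a)) := by
    refine measurable_pi_lambda _ fun i => ?_
    change Measurable fun a => ∑ j, X a i j * toVec (σ a) j
    refine Finset.measurable_sum _ fun j _ => ?_
    exact (measurable_matrix_iff.1 hX i j).mul ((measurable_toVec j).comp hσ)
  exact h.norm

lemma Measurable.hammingDist {α : Type*} [MeasurableSpace α] {n : ℕ} {σ σ' : α → Cube n}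
    (hσ : Measurable σ) (hσ' : Measurable σ') :
    Measurable fun a => (hammingDist (σ a) (σ' a) : ℝ) := by
  have h : Measurable fun a => toVec (σ a) ⬝ᵥ toVec (σ' a) :=
    Finset.measurable_sum _ fun j _ =>
      ((measurable_toVec j).comp hσ).mul ((measurable_toVec j).comp hσ')
  have e : ∀ a, (_root_.hammingDist (σ a) (σ' a) : ℝ) =
      (n - toVec (σ a) ⬝ᵥ toVec (σ' a)) / 2 := fun a => by rw [dotProduct_toVec]; ring
  simp_rw [e]
  exact (measurable_const.sub h).div_const 2

lemma Measurable.frobNorm {α : Type*} [MeasurableSpace α] {M n : ℕ}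
    {X : α → Matrix (Fin M) (Fin n) ℝ} (hX : Measurable X) :
    Measurable fun a => frobNorm (X a) :=
  Real.continuous_sqrt.measurable.comp (Finset.measurable_sum _ fun i _ =>
    Finset.measurable_sum _ fun j _ => (measurable_matrix_iff.1 hX i j).pow_const 2)

lemma frobNorm_sq {M n : ℕ} (X : Matrix (Fin M) (Fin n) ℝ) :
    frobNorm X ^ 2 = ∑ i, ∑ j, X i j ^ 2 :=
  Real.sq_sqrt (Finset.sum_nonneg fun _ _ => Finset.sum_nonneg fun _ _ => sq_nonneg _)

lemma frobNorm_rotated_sub_le {M n : ℕ} (X Y : Matrix (Fin M) (Fin n) ℝ) {s t : ℝ} (h : s ≤ t) :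
    frobNorm (rotated X Y s - rotated X Y t) ≤ (t - s) * √(frobNorm X ^ 2 + frobNorm Y ^ 2) := by
  rw [← Real.sqrt_sq (sub_nonneg.2 h), ← Real.sqrt_mul (sq_nonneg _)]
  refine Real.sqrt_le_sqrt ?_
  rw [frobNorm_sq, frobNorm_sq, ← Finset.sum_add_distrib, Finset.mul_sum]
  refine Finset.sum_le_sum fun i _ => ?_
  rw [← Finset.sum_add_distrib, Finset.mul_sum]
  refine Finset.sum_le_sum fun j _ => ?_
  simp only [rotated, Matrix.sub_apply, Matrix.add_apply, Matrix.smul_apply, smul_eq_mul]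
  set a := Real.cos s - Real.cos t with ha
  set b := Real.sin s - Real.sin t with hb
  -- A chord of the unit circle is no longer than its arc: `a ^ 2 + b ^ 2 = 2 - 2 cos (t - s)`.
  have hab : a ^ 2 + b ^ 2 ≤ (t - s) ^ 2 := by
    have h1 := Real.one_sub_sq_div_two_le_cos (x := t - s)
    rw [Real.cos_sub] at h1
    have h2 := Real.cos_sq_add_sin_sq s
    have h3 := Real.cos_sq_add_sin_sq t
    simp only [ha, hb]
    nlinarith
  have e : Real.cos s * X i j + Real.sin s * Y i j - (Real.cos t * X i j + Real.sin t * Y i j) =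
      a * X i j + b * Y i j := by simp only [ha, hb]; ring
  rw [e]
  calc (a * X i j + b * Y i j) ^ 2 ≤ (a ^ 2 + b ^ 2) * (X i j ^ 2 + Y i j ^ 2) := by
        nlinarith [sq_nonneg (a * Y i j - b * X i j)]
    _ ≤ _ := by gcongr

lemma integral_frobNorm_sq (M n : ℕ) :
    Integrable (fun X => frobNorm X ^ 2) (gaussianMatrix M n) ∧
      ∫ X, frobNorm X ^ 2 ∂(gaussianMatrix M n) = M * n := by
  have hev : ∀ i j, MeasurePreserving (fun X : Matrix (Fin M) (Fin n) ℝ => X i j)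
      (gaussianMatrix M n) (gaussianReal 0 1) := fun i j =>
    (measurePreserving_eval (fun _ : Fin n => gaussianReal 0 1) j).comp
      (measurePreserving_eval
        (fun _ : Fin M => Measure.pi fun _ : Fin n => gaussianReal 0 1) i)
  have h2 : Integrable (fun x : ℝ => x ^ 2) (gaussianReal 0 1) :=
    (memLp_id_gaussianReal (μ := 0) (v := 1) 2).integrable_sq
  have hvar : ∫ x, x ^ 2 ∂(gaussianReal 0 1) = 1 := by
    have := variance_fun_id_gaussianReal (μ := 0) (v := 1)
    rw [variance_eq_integral measurable_id'.aemeasurable] at this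
    simpa using this
  have hint : ∀ i j, Integrable (fun X : Matrix (Fin M) (Fin n) ℝ => X i j ^ 2)
      (gaussianMatrix M n) := fun i j => (hev i j).integrable_comp_of_integrable h2
  simp_rw [frobNorm_sq]
  refine ⟨integrable_finsetSum _ fun i _ => integrable_finsetSum _ fun j _ => hint i j, ?_⟩
  rw [integral_finsetSum _ fun i _ => integrable_finsetSum _ fun j _ => hint i j]
  have : ∀ i, ∫ X, ∑ j, X i j ^ 2 ∂(gaussianMatrix M n) = n := fun i => by
    rw [integral_finsetSum _ fun j _ => hint i j]
    have : ∀ j, ∫ X, X i j ^ 2 ∂(gaussianMatrix M n) = 1 := fun j => by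
      rw [← hvar, ← (hev i j).map_eq, integral_map (hev i j).aemeasurable (by fun_prop)]
    simp [this]
  simp [this]

instance (M n : ℕ) (ρ : ℝ) : IsProbabilityMeasure (correlatedPair M n ρ) :=
  Measure.isProbabilityMeasure_map
    (measurable_fst.prodMk (measurable_lincomb M n _ _)).aemeasurable

/-! ### Failure of stable algorithms -/

/-- For a stable algorithm, along the discretized path from one Gaussian matrix to an independent
one, all runs succeed, all steps are stable and the matrices have moderate Frobenius norm, with
probability at least one half. -/
lemma IsStable.exists_path_event {M n Q : ℕ} (hM : 0 < M) (hn : 0 < n) (hQ : 0 < Q) {Ω : Type*}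
    [MeasurableSpace Ω] {P : Measure Ω} [IsProbabilityMeasure P]
    {A : Matrix (Fin M) (Fin n) ℝ → Ω → Cube n} (hA : Measurable (Function.uncurry A))
    {K p_f p_st f L : ℝ} (hst : IsStable P A K (Real.cos (Real.pi / (2 * Q))) p_f p_st f L)
    (hpf : (Q + 1) * p_f ≤ 1 / 9) (hpst : Q * p_st ≤ 1 / 9) :
    ∃ E : Set ((Matrix (Fin M) (Fin n) ℝ × Ω) × Matrix (Fin M) (Fin n) ℝ), MeasurableSet E ∧
      1 / 2 ≤ (((gaussianMatrix M n).prod P).prod (gaussianMatrix M n)).real E ∧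
      ∀ q ∈ E,
        (∀ k ≤ Q, disc (rotated q.1.1 q.2 (k * (Real.pi / (2 * Q))))
          (A (rotated q.1.1 q.2 (k * (Real.pi / (2 * Q)))) q.1.2) ≤ K) ∧
        (∀ k < Q, (hammingDist (A (rotated q.1.1 q.2 (k * (Real.pi / (2 * Q)))) q.1.2)
            (A (rotated q.1.1 q.2 ((k + 1 : ℕ) * (Real.pi / (2 * Q)))) q.1.2) : ℝ) ≤
          f + L * frobNorm (rotated q.1.1 q.2 (k * (Real.pi / (2 * Q))) -
            rotated q.1.1 q.2 ((k + 1 : ℕ) * (Real.pi / (2 * Q))))) ∧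
        frobNorm q.1.1 ^ 2 + frobNorm q.2 ^ 2 ≤ 12 * (M * n) := by
  set γ := gaussianMatrix M n
  set μ := (γ.prod P).prod γ
  set δ := Real.pi / (2 * Q) with hδ
  have hQ1 : (1 : ℝ) ≤ Q := by exact_mod_cast hQ
  have hδ0 : 0 ≤ δ := by positivity
  have hδ1 : δ ≤ Real.pi := by
    rw [hδ, div_le_iff₀ (by positivity)]
    nlinarith [Real.pi_pos]
  obtain ⟨hs1, hs2⟩ := hst
  set U : Set (Matrix (Fin M) (Fin n) ℝ × Ω) := {q | disc q.1 (A q.1 q.2) ≤ K}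
  set V : Set ((Matrix (Fin M) (Fin n) ℝ × Matrix (Fin M) (Fin n) ℝ) × Ω) :=
    {q | (hammingDist (A q.1.1 q.2) (A q.1.2 q.2) : ℝ) ≤ f + L * frobNorm (q.1.1 - q.1.2)}
  have hU : MeasurableSet U := measurableSet_le (Measurable.disc measurable_fst hA) measurable_const
  have hV : MeasurableSet V := by
    refine measurableSet_le (Measurable.hammingDist
      (hA.comp (f := fun q : (Matrix (Fin M) (Fin n) ℝ × Matrix (Fin M) (Fin n) ℝ) × Ω =>
        (q.1.1, q.2)) (by fun_prop))
      (hA.comp (f := fun q : (Matrix (Fin M) (Fin n) ℝ × Matrix (Fin M) (Fin n) ℝ) × Ω =>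
        (q.1.2, q.2)) (by fun_prop)))
      (measurable_const.add ((Measurable.frobNorm ?_).const_mul L))
    have h1 := measurable_matrix_iff.1 (measurable_fst (α := Matrix (Fin M) (Fin n) ℝ)
      (β := Matrix (Fin M) (Fin n) ℝ))
    have h2 := measurable_matrix_iff.1 (measurable_snd (α := Matrix (Fin M) (Fin n) ℝ)
      (β := Matrix (Fin M) (Fin n) ℝ))
    exact measurable_matrix_iff.2 fun i j =>
      ((h1 i j).comp measurable_fst).sub ((h2 i j).comp measurable_fst)
  let φ : ℕ → (Matrix (Fin M) (Fin n) ℝ × Ω) × Matrix (Fin M) (Fin n) ℝ →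
    Matrix (Fin M) (Fin n) ℝ × Ω := fun k q => (rotated q.1.1 q.2 (k * δ), q.1.2)
  let ψ : ℕ → (Matrix (Fin M) (Fin n) ℝ × Ω) × Matrix (Fin M) (Fin n) ℝ →
    (Matrix (Fin M) (Fin n) ℝ × Matrix (Fin M) (Fin n) ℝ) × Ω :=
    fun k q => ((rotated q.1.1 q.2 (k * δ), rotated q.1.1 q.2 ((k + 1 : ℕ) * δ)), q.1.2)
  have hφ : ∀ k, MeasurePreserving (φ k) μ (γ.prod P) := fun k =>
    ((measurePreserving_interp M n (k * δ)).prod (MeasurePreserving.id P)).comp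
      (measurePreserving_rearrange γ P)
  have hψ : ∀ k, MeasurePreserving (ψ k) μ ((correlatedPair M n (Real.cos δ)).prod P) := fun k => by
    convert! ((measurePreserving_interp_pair M n (k * δ) hδ0 hδ1).prod
      (MeasurePreserving.id P)).comp (measurePreserving_rearrange γ P) using 1
    funext q
    have : ((k + 1 : ℕ) : ℝ) * δ = k * δ + δ := by push_cast; ring
    simp only [ψ, this]
    rfl
  let N : (Matrix (Fin M) (Fin n) ℝ × Ω) × Matrix (Fin M) (Fin n) ℝ → ℝ :=
    fun q => frobNorm q.1.1 ^ 2 + frobNorm q.2 ^ 2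
  have hN : Measurable N :=
    ((Measurable.frobNorm (by fun_prop)).pow_const 2).add
      ((Measurable.frobNorm (by fun_prop)).pow_const 2)
  let F : Set ((Matrix (Fin M) (Fin n) ℝ × Ω) × Matrix (Fin M) (Fin n) ℝ) :=
    {q | N q ≤ 12 * (M * n)}
  have hF : MeasurableSet F := measurableSet_le hN measurable_const
  have hUc : ∀ k, μ.real (φ k ⁻¹' U)ᶜ ≤ p_f := fun k => by
    rw [← Set.preimage_compl, (hφ k).measureReal_preimage hU.compl.nullMeasurableSet,
      probReal_compl_eq_one_sub hU]
    linarith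
  have hVc : ∀ k, μ.real (ψ k ⁻¹' V)ᶜ ≤ p_st := fun k => by
    rw [← Set.preimage_compl, (hψ k).measureReal_preimage hV.compl.nullMeasurableSet,
      probReal_compl_eq_one_sub hV]
    linarith
  -- Markov: the sum of the squared norms has mean `2 M n`, against the threshold `12 M n`. The
  -- total failure probability is at most `1/9 + 1/9 + 1/6 < 1/2`.
  have hFc : μ.real Fᶜ ≤ 1 / 6 := by
    obtain ⟨i1, i2⟩ : Integrable (fun X => frobNorm X ^ 2) γ ∧ ∫ X, frobNorm X ^ 2 ∂γ = M * n :=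
      integral_frobNorm_sq M n
    have p1 : MeasurePreserving (fun q : (Matrix (Fin M) (Fin n) ℝ × Ω) ×
        Matrix (Fin M) (Fin n) ℝ => q.1.1) μ γ :=
      measurePreserving_fst.comp measurePreserving_fst
    have p2 : MeasurePreserving (fun q : (Matrix (Fin M) (Fin n) ℝ × Ω) ×
        Matrix (Fin M) (Fin n) ℝ => q.2) μ γ := measurePreserving_snd
    have j1 := p1.integrable_comp_of_integrable i1
    have j2 := p2.integrable_comp_of_integrable i1
    have k1 : ∫ q, frobNorm q.1.1 ^ 2 ∂μ = M * n := by
      rw [← i2, ← p1.map_eq, integral_map p1.aemeasurable]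
      exact ((Measurable.frobNorm measurable_id).pow_const 2).aestronglyMeasurable
    have k2 : ∫ q, frobNorm q.2 ^ 2 ∂μ = M * n := by
      rw [← i2, ← p2.map_eq, integral_map p2.aemeasurable]
      exact ((Measurable.frobNorm measurable_id).pow_const 2).aestronglyMeasurable
    have hmark := mul_meas_ge_le_integral_of_nonneg (μ := μ) (f := N)
      (Filter.Eventually.of_forall fun q => by positivity) (j1.add j2) (12 * (M * n))
    have hint : ∫ q, N q ∂μ = 2 * (M * n) := by
      have := integral_add j1 j2
      simp only [Function.comp_def] at this
      rw [k1, k2] at this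
      simp only [N]
      rw [this]; ring
    rw [hint] at hmark
    have hMn : (0 : ℝ) < M * n := by positivity
    have hsub : Fᶜ ⊆ {q | 12 * (M * n : ℝ) ≤ N q} := fun q hq => le_of_lt (not_le.1 (show ¬ N q ≤ 12 * (M * n) from hq))
    have := measureReal_mono (μ := μ) hsub (measure_ne_top _ _)
    nlinarith
  have hE : MeasurableSet ((⋂ k ∈ Finset.range (Q + 1), φ k ⁻¹' U) ∩
      (⋂ k ∈ Finset.range Q, ψ k ⁻¹' V) ∩ F) := by
    refine MeasurableSet.inter (MeasurableSet.inter ?_ ?_) hF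
    · exact Finset.measurableSet_biInter _ fun k _ => hU.preimage (hφ k).measurable
    · exact Finset.measurableSet_biInter _ fun k _ => hV.preimage (hψ k).measurable
  refine ⟨_, hE, ?_, ?_⟩
  · have hc := probReal_compl_eq_one_sub (μ := μ) hE
    have h1 : μ.real (⋃ k ∈ Finset.range (Q + 1), (φ k ⁻¹' U)ᶜ) ≤ 1 / 9 := by
      refine (measureReal_biUnion_finset_le _ _).trans
        ((Finset.sum_le_card_nsmul _ _ p_f fun k _ => hUc k).trans ?_)
      simpa using hpf
    have h2 : μ.real (⋃ k ∈ Finset.range Q, (ψ k ⁻¹' V)ᶜ) ≤ 1 / 9 := by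
      refine (measureReal_biUnion_finset_le _ _).trans
        ((Finset.sum_le_card_nsmul _ _ p_st fun k _ => hVc k).trans ?_)
      simpa using hpst
    simp only [Set.compl_inter, Set.compl_iInter] at hc
    have h3 := (measureReal_union_le (μ := μ) ((⋃ k ∈ Finset.range (Q + 1), (φ k ⁻¹' U)ᶜ) ∪
      (⋃ k ∈ Finset.range Q, (ψ k ⁻¹' V)ᶜ)) Fᶜ)
    have h4 := (measureReal_union_le (μ := μ) (⋃ k ∈ Finset.range (Q + 1), (φ k ⁻¹' U)ᶜ)
      (⋃ k ∈ Finset.range Q, (ψ k ⁻¹' V)ᶜ))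
    linarith
  · rintro q ⟨⟨h1, h2⟩, h3⟩
    simp only [Set.mem_iInter, Finset.mem_range] at h1 h2
    exact ⟨fun k hk => h1 k (by omega), fun k hk => h2 k hk, h3⟩

lemma one_le_constT (m Q : ℕ) : 1 ≤ constT m Q :=
  Real.one_le_rpow (by norm_num) (by positivity)

/-- On the event that the Frobenius norms are moderate, one stable step moves the output by less
than `η n / 4`. -/
lemma stable_step_le {M n Q : ℕ} (hM : 0 < M) {L η δ N : ℝ} (hQ : 0 < Q)
    (hη : 0 < η) (hη1 : η ≤ 1) (hQL : 4800 * L * Real.pi / η ^ 2 ≤ Q)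
    (hδ : δ = Real.pi / (2 * Q)) (hN : N ≤ 12 * (M * n)) :
    constC η * n + L * √((n : ℝ) / M) * (δ * √N) ≤ η / 4 * n := by
  have hM' : (0 : ℝ) < M := by exact_mod_cast hM
  have hQ' : (0 : ℝ) < Q := by exact_mod_cast hQ
  have hδ0 : 0 ≤ δ := by rw [hδ]; positivity
  have h1 : √((n : ℝ) / M) * √N ≤ 4 * n := by
    rw [← Real.sqrt_mul (by positivity)]
    refine Real.sqrt_le_iff.2 ⟨by positivity, ?_⟩
    calc (n : ℝ) / M * N ≤ n / M * (12 * (M * n)) := by gcongr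
      _ = 12 * (n : ℝ) ^ 2 := by field_simp
      _ ≤ (4 * n : ℝ) ^ 2 := by nlinarith [sq_nonneg (n : ℝ)]
  have h2 : L * δ ≤ η ^ 2 / 9600 := by
    rw [div_le_iff₀ (by positivity)] at hQL
    rw [hδ, ← mul_div_assoc, div_le_iff₀ (by positivity)]
    linarith
  have h3 : η ^ 2 ≤ η := by nlinarith
  calc constC η * n + L * √((n : ℝ) / M) * (δ * √N)
      = constC η * n + L * δ * (√((n : ℝ) / M) * √N) := by ring
    _ ≤ constC η * n + η ^ 2 / 9600 * (4 * n) := by gcongr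
    -- `1 / 1600 + 4 / 9600 = 1 / 960`, well below the `1 / 4` needed.
    _ = η ^ 2 * (n * (1 / 960)) := by rw [constC]; ring
    _ ≤ η * (n * (1 / 960)) := by gcongr
    _ ≤ _ := by nlinarith [mul_nonneg hη.le (Nat.cast_nonneg n : (0 : ℝ) ≤ n)]

/-- Only the failure probabilities summed along a single path matter. The replicas cost a factor `2
^ (-R)` by Jensen, not a union bound over `R` paths, so no bound on the Ramsey number `R` is needed.
-/
theorem exists_forall_not_isStable {K C₁ c₂ β η : ℝ} {m : ℕ} (hK : 0 < K) (hc₂ : 0 < c₂)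
    (hC : 0 < C₁) (hm : 1 ≤ m) (hmC : 16 * C₁ ≤ m) (hβ : 1 / 2 < β) (hβ1 : β < 1)
    (hent : entropy2 (1 - β) ≤ 1 / (4 * C₁)) (hη : 0 < η) (hw : η * m ≤ (1 - β) / 2)
    {L : ℝ} (hL : 0 < L) {Q : ℕ} (hQ : Q = constQ L η) :
    ∃ n₀ : ℕ, ∀ n : ℕ, n₀ ≤ n → ∀ M : ℕ, Regime C₁ c₂ M n →
      ∀ (Ω : Type*) [MeasurableSpace Ω] (P : Measure Ω) [IsProbabilityMeasure P]
        (A : Matrix (Fin M) (Fin n) ℝ → Ω → Cube n), Measurable (Function.uncurry A) →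
        ∀ {p_f p_st : ℝ}, (Q + 1) * p_f ≤ 1 / 9 → Q * p_st ≤ 1 / 9 →
          ¬ IsStable P A K (Real.cos (Real.pi / (2 * Q))) p_f p_st
            (constC η * n) (L * √((n : ℝ) / M)) := by
  classical
  have hQL : 4800 * L * Real.pi / η ^ 2 ≤ Q := hQ ▸ Nat.le_ceil _
  have hQ0 : 0 < Q := by
    have : (0 : ℝ) < Q := lt_of_lt_of_le (by have := Real.pi_pos; positivity) hQL
    exact_mod_cast this
  have hη1 : η ≤ 1 := by
    have : (1 : ℝ) ≤ m := by exact_mod_cast hm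
    nlinarith
  obtain ⟨R, hR⟩ := exists_forbidden_tuple m Q
  obtain ⟨n₁, hn₁, hprob⟩ :=
    exists_forall_prob_exists_tuple_le hK hc₂ hC hm hmC hβ hβ1 hent hη.le hw
  let J : Finset ((Fin m → Fin R) × ℕ) :=
    (Finset.univ.filter fun ι : Fin m → Fin R => Function.Injective ι) ×ˢ Finset.range (Q + 1)
  -- `J` does not depend on `n`. This threshold gives `|J| 2 ^ R ≤ n < 2 ^ n`, which contradicts `2
  -- ^ (-R) ≤ |J| 2 ^ (-3 n)`.
  refine ⟨n₁ + J.card * 2 ^ R, fun n hn M hreg Ω _ P _ A hA p_f p_st hpf hpst hst => ?_⟩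
  have hn0 : 0 < n := by omega
  have hM : 0 < M := by
    rcases Nat.eq_zero_or_pos M with rfl | h
    · have := hreg.1
      simp only [Nat.cast_zero, mul_zero, zero_mul] at this
      have : (0 : ℝ) < n := by exact_mod_cast hn0
      linarith
    · exact h
  obtain ⟨E, hE, hE2, hEq⟩ := hst.exists_path_event hM hn0 hQ0 hA hpf hpst
  set γ := gaussianMatrix M n
  set δ := Real.pi / (2 * Q) with hδ
  have hδ0 : 0 ≤ δ := by have := Real.pi_pos; positivity
  let bad : ℕ → Set (Fin (m + 1) → Matrix (Fin M) (Fin n) ℝ) := fun k =>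
    {G | ∃ σ : Fin m → Cube n, (∀ i j : Fin m, i < j → β - η ≤ overlap (σ i) (σ j)) ∧
      ((∀ i j : Fin m, i < j → overlap (σ i) (σ j) ≤ β) ∨
        ∀ _ : Fin m, Real.cos (k * δ) = 0) ∧
      ∀ i, disc (interp G i (k * δ)) (σ i) ≤ K}
  let sel : (Fin m → Fin R) → (Matrix (Fin M) (Fin n) ℝ × Ω) × (Fin R → Matrix (Fin M) (Fin n) ℝ) →
    (Fin (m + 1) → Matrix (Fin M) (Fin n) ℝ) := fun ι q => Fin.cons q.1.1 fun i => q.2 (ι i)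
  set μ := (γ.prod P).prod (Measure.pi fun _ : Fin R => γ)
  have hsub : {q : (Matrix (Fin M) (Fin n) ℝ × Ω) × (Fin R → Matrix (Fin M) (Fin n) ℝ) |
      ∀ i, (q.1, q.2 i) ∈ E} ⊆ ⋃ p ∈ J, sel p.1 ⁻¹' bad p.2 := by
    intro q hq
    obtain ⟨ι, hι, k, hk, ho1, ho2⟩ := hR n β η
      (fun i k => A (rotated q.1.1 (q.2 i) (k * δ)) q.1.2) hn0 hβ1 hη.le
      -- At angle `0` every path is at `M₀`, and all runs share `ω`, so the outputs agree.
      (fun i j => by simp [rotated]) fun i k hk => by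
        obtain ⟨-, h2, h3⟩ := hEq _ (hq i)
        have hle : (k : ℝ) * δ ≤ (k + 1 : ℕ) * δ := by
          push_cast
          linarith
        refine (h2 k hk).trans (le_trans ?_ (stable_step_le hM hQ0 hη hη1 hQL hδ h3))
        have hd : ((k + 1 : ℕ) : ℝ) * δ - k * δ = δ := by push_cast; ring
        have := frobNorm_rotated_sub_le q.1.1 (q.2 i) hle
        rw [hd] at this
        gcongr
    simp only [Set.mem_iUnion]
    refine ⟨(ι, k), Finset.mem_product.2
      ⟨Finset.mem_filter.2 ⟨Finset.mem_univ _, hι⟩, Finset.mem_range.2 (by omega)⟩,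
      fun i => A (rotated q.1.1 (q.2 (ι i)) (k * δ)) q.1.2, ho1,
      ho2.imp_right fun h _ => ?_, fun i => (hEq _ (hq (ι i))).1 k hk⟩
    have hQ' : (Q : ℝ) ≠ 0 := by positivity
    have : (Q : ℝ) * δ = Real.pi / 2 := by
      rw [hδ]
      field_simp
    rw [h, this, Real.cos_pi_div_two]
  have hbad : ∀ p ∈ J, μ.real (sel p.1 ⁻¹' bad p.2) ≤ (2 : ℝ) ^ (-(3 * n : ℝ)) := by
    intro p hp
    have hsel := measurePreserving_select γ P
      (Finset.mem_filter.1 (Finset.mem_product.1 hp).1).2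
    refine le_trans ?_ (hprob n (by omega) M hreg fun _ => p.2 * δ)
    refine ENNReal.toReal_mono (measure_ne_top _ _) ?_
    -- This inequality holds for arbitrary sets, so `bad` need not be shown measurable.
    exact (Measure.le_map_apply hsel.aemeasurable _).trans_eq (by rw [hsel.map_eq])
  have hlow : (1 / 2 : ℝ) ^ R ≤ J.card * (2 : ℝ) ^ (-(3 * n : ℝ)) := by
    refine (pow_le_pow_left₀ (by norm_num) hE2 R).trans
      ((pow_le_prob_forall_replicas _ _ hE R).trans ?_)
    refine (measureReal_mono hsub (measure_ne_top _ _)).trans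
      ((measureReal_biUnion_finset_le _ _).trans ?_)
    exact (Finset.sum_le_card_nsmul _ _ _ hbad).trans_eq (nsmul_eq_mul _ _)
  have hup : (J.card : ℝ) * 2 ^ R < (2 : ℝ) ^ (3 * n : ℝ) := by
    have h1 : J.card * 2 ^ R < 2 ^ n := lt_of_le_of_lt (by omega) Nat.lt_two_pow_self
    have h2 : (J.card : ℝ) * 2 ^ R < (2 : ℝ) ^ (n : ℝ) := by
      rw [Real.rpow_natCast]
      exact_mod_cast h1
    refine h2.trans_le (Real.rpow_le_rpow_of_exponent_le (by norm_num) ?_)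
    have : (0 : ℝ) ≤ n := Nat.cast_nonneg n
    linarith
  rw [Real.rpow_neg (by norm_num), ← div_eq_mul_inv, one_div, inv_pow,
    inv_le_iff_one_le_mul₀ (by positivity), mul_comm, ← mul_div_assoc,
    le_div_iff₀ (by positivity)] at hlow
  linarith

end StableDisc

end

theorem theorem3p4 (K C₁ c₂ : ℝ) (hK : 0 < K) (hc₂ : 0 < c₂) (hC₁ : c₂ < C₁)
    (m : ℕ) (hm : m = StableDisc.ogpSize C₁)
    (β : ℝ) (hβ : 1 / 2 < β) (hβ_lt : β < 1)
    (hβ_eq : StableDisc.entropy2 (1 - β) = min (1 / (4 * C₁)) (1 / 2))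
    (η : ℝ) (hη : η = StableDisc.ogpWidth m β) :
    0 < η ∧ η < β ∧ StableDisc.EnsembleOGP K C₁ c₂ m β η ∧
    ∀ L : ℝ, 0 < L → ∀ C T : ℝ, ∀ Q : ℕ,
      C = StableDisc.constC η → Q = StableDisc.constQ L η → T = StableDisc.constT m Q →
      ∃ n₀ : ℕ, ∀ n : ℕ, n₀ ≤ n → ∀ M : ℕ, StableDisc.Regime C₁ c₂ M n →
        ∀ (Ω : Type*) [MeasurableSpace Ω] (P : Measure Ω) [IsProbabilityMeasure P]
          (A : Matrix (Fin M) (Fin n) ℝ → Ω → StableDisc.Cube n),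
          Measurable (Function.uncurry A) →
          ¬ StableDisc.IsStable P A K (Real.cos (Real.pi / (2 * Q)))
              (1 / (9 * ((Q : ℝ) + 1) * T)) (1 / (9 * (Q : ℝ) * (T + 1)))
              (C * n) (L * Real.sqrt ((n : ℝ) / M)) := by
  have hC : 0 < C₁ := hc₂.trans hC₁
  have hm2 : 2 ≤ m := hm ▸ le_max_left _ _
  have hmC : 16 * C₁ ≤ m := (Nat.le_ceil _).trans (by
    rw [hm]
    exact_mod_cast le_max_right _ _)
  have hm2' : (2 : ℝ) ≤ m := by exact_mod_cast hm2
  have hent : StableDisc.entropy2 (1 - β) ≤ 1 / (4 * C₁) := hβ_eq ▸ min_le_left _ _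
  have hw : η * m = (1 - β) / 2 := by
    rw [hη, StableDisc.ogpWidth]
    field_simp
  have hη0 : 0 < η := by
    rw [hη]
    exact div_pos (by linarith) (by linarith)
  refine ⟨hη0, by nlinarith, StableDisc.ensembleOGP hK hc₂ hC (by omega) hmC hβ hβ_lt hent hη0.le
    hw.le, ?_⟩
  rintro L hL C T Q rfl hQ rfl
  obtain ⟨n₀, h⟩ := StableDisc.exists_forall_not_isStable hK hc₂ hC (by omega) hmC hβ hβ_lt hent
    hη0 hw.le hL hQ
  -- `T ≥ 1` suffices: both prescribed probabilities then sum to at most `1 / 9` along one path.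
  have hT := StableDisc.one_le_constT m Q
  have hQ0 : (0 : ℝ) ≤ Q := Nat.cast_nonneg Q
  refine ⟨n₀, fun n hn M hreg Ω _ P _ A hA => h n hn M hreg Ω P A hA ?_ ?_⟩
  · rw [mul_one_div, div_le_div_iff₀ (by positivity) (by norm_num)]
    nlinarith
  · rw [mul_one_div]
    refine div_le_of_le_mul₀ (by positivity) (by norm_num) ?_
    nlinarith
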